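/- Let $\mathcal S=\mathcal S(\mathbb R)$ be the real Schwartz space (phase space and space of tangent vectors), with cotangent vectors represented by elements of $\mathcal S$ through $\langle a,s\rangle=\int_{\mathbb R}a\,s\,dx$; on $\mathcal S^2$ use $\langle a,s\rangle=\langle a_0,s_0\rangle+\langle a_1,s_1\rangle$. An evolution system $u_t=K(u)$ is identified with its vector field $K$. Smooth means $C^\infty$ in the sense of Michal–Bastiani, $X'(u)[v]=\frac{\partial}{\partial\varepsilon}X(u+\varepsilon v)|_{\varepsilon=0}$, and $[K,S](u)=K'(u)[S(u)]-S'(u)[K(u)]$. Write $\partial=d/dx$, $(\partial^{-1}s)(x)=\int_{-\infty}^x s\,dy$, and $$\Phi(u)=\partial^2+2u_x\partial^{-1}+4u,\quad M(u)=\partial^3+2(\partial u+u\partial),\quad K_n(u)=\Phi(u)^nu_x,$$ $$\tilde H_n(u)=\int_{\mathbb R}\int_0^1u\,f_n(\lambda u)\,d\lambda\,dx,\quad f_n(u)=\Psi(u)^nu,\quad \Psi(u)=\partial^2+4u-2\partial^{-1}u_x .$$ Definitions. A smooth field of linear operators $J$ is Hamiltonian if it is skew-symmetric and $\langle a,J'(u)[J(u)b]c\rangle+\mathrm{cycle}(a,b,c)=0$;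 $J,M$ form a Hamiltonian pair if $cJ+dM$ is Hamiltonian for all real $c,d$. A smooth cotangent field $\gamma=\delta H/\delta u$ is the variational derivative of a smooth functional $H$ if $H'(u)[v]=\langle\gamma(u),v\rangle$. A smooth field of operators $\Phi$ is hereditary if $\Phi'[\Phi k]s-\Phi\Phi'[k]s-\Phi'[\Phi s]k+\Phi\Phi'[s]k=0$ for all $k,s$; a time-independent $\Phi$ is a recursion operator of $u_t=K(u)$ if $\Phi'[K]s-K'[\Phi s]+\Phi K'[s]=0$ for all $s$. The system $u_t=K(u)$ with $K$ smooth is integrable if $K=J\,\delta H/\delta u$ for some Hamiltonian operator $J$ and functional $H$, and there are conserved functionals $I_0,I_1,\dots$ of the system in involution with respect to $J$ whose Hamiltonian vector fields $X_m=J\,\delta I_m/\delta u$ satisfy $[K,X_m]=[X_l,X_m]=0$ and are such that, for every $N$, the vectors $X_0(u),\dots,X_{N-1}(u)$ are linearly independent for a dense set of $u$. A system on $\mathcal S^2$ is an integrable coupling of an integrable system $u_t=K(u)$ if it is integrable and has the form $u_t=K(u)$, $v_t=S(u,v)$ with $\partial S/\partial[u]\neq0$, i.e. the Gateaux derivative of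 $S$ with respect to $u$ exists and is nonzero at some point in some direction. **Theorem.** Let $n\ge1$ and let $\alpha\ne0$ be a real constant. The first-order perturbation system of $u_t=K_n(u)+\alpha\varepsilon K_n(u)$, obtained by inserting $\hat u=\eta_0+\varepsilon\eta_1$ and taking the coefficients of $\varepsilon^0$ and $\varepsilon^1$, is well defined on $\mathcal S^2$ and reads $$\eta_{0t}=K_n(\eta_0),\qquad \eta_{1t}=K_n'(\eta_0)[\eta_1]+\alpha K_n(\eta_0).$$ 1. It is an integrable coupling of the $n$-th KdV equation $u_t=K_n(u)$. 2. With $\hat\eta=(\eta_0,\eta_1)^T$, $M_0=M(\eta_0)$, $M_1=2(\partial\eta_1+\eta_1\partial)$ and $(\mathrm{per}_1\tilde H)(\hat\eta)=\frac{\partial}{\partial\varepsilon}\tilde H(\eta_0+\varepsilon\eta_1)|_{\varepsilon=0}$, it has the quadruple Hamiltonian formulation $$\hat\eta_t=\begin{bmatrix}0&\partial\\\partial&0\end{bmatrix}\frac{\delta(\mathrm{per}_1\tilde H_n+\alpha\tilde H_n(\eta_0))}{\delta\hat\eta}=\begin{bmatrix}0&M_0\\M_0&M_1\end{bmatrix}\frac{\delta(\mathrm{per}_1\tilde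 H_{n-1}+\alpha\tilde H_{n-1}(\eta_0))}{\delta\hat\eta}$$ $$=\begin{bmatrix}0&\partial\\\partial&\alpha\partial\end{bmatrix}\frac{\delta(\mathrm{per}_1\tilde H_n)}{\delta\hat\eta}=\begin{bmatrix}0&M_0\\M_0&M_1+\alpha M_0\end{bmatrix}\frac{\delta(\mathrm{per}_1\tilde H_{n-1})}{\delta\hat\eta},$$ and any two of the four operators form a Hamiltonian pair. 3. With $\Phi_0=\Phi(\eta_0)$ and $\Phi_1=2(\partial\eta_1\partial^{-1}+\eta_1)=2\eta_{1x}\partial^{-1}+4\eta_1$, for all real $\beta_0,\beta_1$ the operators $$\hat\Phi^{(1)}(\beta)=\begin{bmatrix}\beta_0&0\\\beta_1&\beta_0\end{bmatrix},\qquad \hat\Phi^{(2)}(\beta)=\begin{bmatrix}\beta_0\Phi_0&0\\\beta_0\Phi_1+\beta_1\Phi_0&\beta_0\Phi_0\end{bmatrix}$$ are hereditary recursion operators of this system. -/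

import Mathlib

open Filter Topology MeasureTheory
open scoped SchwartzMap

noncomputable section

namespace PerturbedKdV

/-! ### Calculus of fields on a (function) space

A phase space is a real topological vector space `E`.  A vector field is a map `K : E → E`; it
stands for the autonomous evolution system `u_t = K(u)`. -/

section Calculus

variable {E F : Type*} [AddCommGroup E] [Module ℝ E] [TopologicalSpace E]
  [AddCommGroup F] [Module ℝ F] [TopologicalSpace F]

/-- The curve `c` has derivative `w` at `0`. -/
def HasCurveDeriv (c : ℝ → F) (w : F) : Prop :=
  Tendsto (fun t : ℝ => t⁻¹ • (c t - c 0)) (𝓝[≠] 0) (𝓝 w)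

/-- The derivative at `0` of the curve `c` (meaningful when it exists). -/
def curveDeriv (c : ℝ → F) : F :=
  limUnder (𝓝[≠] 0) (fun t : ℝ => t⁻¹ • (c t - c 0))

/-- The Gateaux derivative `X'(u)[v] = ∂/∂ε X(u + ε v)` at `ε = 0`. -/
def gateaux (X : E → F) (u v : E) : F :=
  curveDeriv (fun ε : ℝ => X (u + ε • v))

/-- `X` is smooth: there are iterated directional derivatives
`D k u (v₁, …, v_k) = X^{(k)}(u)[v₁, …, v_k]` of all orders, jointly continuous in all variables
(the Michal–Bastiani notion of a `C^∞` map). -/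
def IsSmooth (X : E → F) : Prop :=
  ∃ D : (k : ℕ) → E → (Fin k → E) → F,
    (∀ u v, D 0 u v = X u) ∧
    (∀ k, Continuous (fun p : E × (Fin k → E) => D k p.1 p.2)) ∧
    (∀ k u v w, HasCurveDeriv (fun ε : ℝ => D k (u + ε • w) v) (D (k + 1) u (Fin.cons w v)))

/-- The commutator `[K, S](u) = K'(u)[S(u)] - S'(u)[K(u)]` of vector fields. -/
def commutator (K S : E → E) (u : E) : E :=
  gateaux K u (S u) - gateaux S u (K u)

/-- For a field of linear operators `Φ`, the operator `s ↦ Φ'(u)[v] s`. -/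
def opDeriv (Φ : E → E →ₗ[ℝ] E) (u v s : E) : E :=
  gateaux (fun u' => Φ u' s) u v

/-- A smooth field of linear operators. -/
def IsSmoothOp (Φ : E → E →ₗ[ℝ] E) : Prop :=
  IsSmooth (fun p : E × E => Φ p.1 p.2)

/-- Hereditary operators. -/
def IsHereditary (Φ : E → E →ₗ[ℝ] E) : Prop :=
  IsSmoothOp Φ ∧ ∀ u k s : E,
    opDeriv Φ u (Φ u k) s - Φ u (opDeriv Φ u k s)
      - opDeriv Φ u (Φ u s) k + Φ u (opDeriv Φ u s k) = 0

/-- `Φ` (with no explicit dependence on time) is a recursion operator of `u_t = K(u)`. -/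
def IsRecursionOperator (K : E → E) (Φ : E → E →ₗ[ℝ] E) : Prop :=
  IsSmoothOp Φ ∧ ∀ u s : E,
    opDeriv Φ u (K u) s - gateaux K u (Φ u s) + Φ u (gateaux K u s) = 0

/-! Cotangent vectors are represented by elements of `E` through a pairing
`B α K = <α, K>` of cotangent vectors with tangent vectors. -/

/-- Hamiltonian operators: smooth, skew-symmetric, and satisfying the Jacobi identity. -/
def IsHamiltonianOp (B : E → E → ℝ) (J : E → E →ₗ[ℝ] E) : Prop :=
  IsSmoothOp J ∧
  (∀ u a b : E, B a (J u b) = -B b (J u a)) ∧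
  ∀ u a b c : E,
    B a (opDeriv J u (J u b) c) + B b (opDeriv J u (J u c) a) + B c (opDeriv J u (J u a) b) = 0

/-- Hamiltonian pairs. -/
def IsHamiltonianPair (B : E → E → ℝ) (J M : E → E →ₗ[ℝ] E) : Prop :=
  ∀ c d : ℝ, IsHamiltonianOp B (fun u => c • J u + d • M u)

/-- The smooth functional `H` has the smooth cotangent field `γ` as its variational derivative. -/
def IsVariationalDerivative (B : E → E → ℝ) (H : E → ℝ) (γ : E → E) : Prop :=
  IsSmooth H ∧ IsSmooth γ ∧
  ∀ u v : E, HasCurveDeriv (fun ε : ℝ => H (u + ε • v)) (B (γ u) v)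

/-- `u_t = K(u) = J(u) δH/δu` with `J` a Hamiltonian operator. -/
def IsHamiltonianForm (B : E → E → ℝ) (K : E → E) (J : E → E →ₗ[ℝ] E) (H : E → ℝ) : Prop :=
  IsHamiltonianOp B J ∧
  ∃ γ : E → E, IsVariationalDerivative B H γ ∧ ∀ u, K u = J u (γ u)

/-- Integrability of `u_t = K(u)`: the system is Hamiltonian and has infinitely many conserved
functionals `H₀, H₁, …` in involution, whose Hamiltonian vector fields are pairwise commuting
symmetries and are functionally independent (any finitely many of them are linearly independent
at the points of a dense set). -/
def IsIntegrable (B : E → E → ℝ) (K : E → E) : Prop :=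
  IsSmooth K ∧
  ∃ (J : E → E →ₗ[ℝ] E) (H : E → ℝ) (I : ℕ → E → ℝ) (γ : ℕ → E → E),
    IsHamiltonianForm B K J H ∧
    (∀ m, IsVariationalDerivative B (I m) (γ m)) ∧
    (∀ m u, B (γ m u) (K u) = 0) ∧
    (∀ l m u, B (γ l u) (J u (γ m u)) = 0) ∧
    (∀ m u, commutator K (fun w => J w (γ m w)) u = 0) ∧
    (∀ l m u, commutator (fun w => J w (γ l w)) (fun w => J w (γ m w)) u = 0) ∧
    ∀ N : ℕ, Dense {u : E | LinearIndependent ℝ (fun m : Fin N => J u (γ m u))}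

/-- The system `(u, v)_t = G(u, v)` is an integrable coupling of the integrable system
`u_t = K(u)`: it is integrable, it has the form `u_t = K(u)`, `v_t = S(u, v)`, and the
non-triviality condition `∂S/∂[u] ≠ 0` holds. -/
def IsIntegrableCoupling (B : E → E → ℝ) (B' : E × E → E × E → ℝ)
    (K : E → E) (G : E × E → E × E) : Prop :=
  IsIntegrable B K ∧ IsIntegrable B' G ∧
  (∀ u v, (G (u, v)).1 = K u) ∧
  ∃ u v w z : E, z ≠ 0 ∧ HasCurveDeriv (fun ε : ℝ => (G (u + ε • w, v)).2) z

/-- First-order perturbation `per₁ K` of a vector field depending on a parameter `ε`: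
with `û = η₀ + ε η₁`, its components are `K(û, ε)` and `∂/∂ε K(û, ε)` at `ε = 0`. -/
def perField (K : ℝ → E → E) (η : E × E) : E × E :=
  (K 0 η.1, curveDeriv (fun ε : ℝ => K ε (η.1 + ε • η.2)))

/-- First-order perturbation `per₁ H` of a functional: `∂/∂ε H(η₀ + ε η₁)` at `ε = 0`. -/
def perFunctional (H : E → ℝ) (η : E × E) : ℝ :=
  curveDeriv (fun ε : ℝ => H (η.1 + ε • η.2))

/-- The `2 × 2` matrix of operators with rows `(a, b)` and `(c, d)`. -/
def blockOp (a b c d : E →ₗ[ℝ] E) : E × E →ₗ[ℝ] E × E :=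
  (a.coprod b).prod (c.coprod d)

end Calculus

/-! ### The KdV hierarchy on the Schwartz space -/

/-- The spatial derivative `∂`. -/
def dx : 𝓢(ℝ, ℝ) →ₗ[ℝ] 𝓢(ℝ, ℝ) := (SchwartzMap.derivCLM ℝ ℝ).toLinearMap

/-- `∂⁻¹ s (x) = ∫_{-∞}^x s(y) dy`. -/
def invDx (s : ℝ → ℝ) (x : ℝ) : ℝ := ∫ y in Set.Iic x, s y

theorem hasDerivAt_invDx (s : 𝓢(ℝ, ℝ)) (x : ℝ) : HasDerivAt (invDx s) (s x) x := by
  have hs : Integrable (s : ℝ → ℝ) volume := s.integrable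
  have h1 : invDx s = fun x => (∫ y in Set.Iic (0 : ℝ), s y) + ∫ y in (0 : ℝ)..x, s y := by
    funext x
    have := intervalIntegral.integral_Iic_sub_Iic (f := (s : ℝ → ℝ)) (μ := volume)
      (a := 0) (b := x) hs.integrableOn hs.integrableOn
    simp only [invDx]
    linarith
  rw [h1]
  exact (intervalIntegral.integral_hasDerivAt_right
    (hs.intervalIntegrable) (s.continuous.stronglyMeasurableAtFilter _ _)
    s.continuous.continuousAt).const_add _

theorem hasTemperateGrowth_invDx (s : 𝓢(ℝ, ℝ)) : (invDx s).HasTemperateGrowth := by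
  have hs : Integrable (s : ℝ → ℝ) volume := s.integrable
  refine Function.HasTemperateGrowth.of_fderiv (k := 0) (C := ∫ y, ‖s y‖) ?_
    (fun x => (hasDerivAt_invDx s x).differentiableAt) ?_
  · have : fderiv ℝ (invDx s) = fun x => ContinuousLinearMap.toSpanSingleton ℝ (s x) := by
      funext x
      exact (hasDerivAt_invDx s x).hasFDerivAt.fderiv
    rw [this]
    exact (ContinuousLinearMap.hasTemperateGrowth
      (ContinuousLinearMap.toSpanSingletonCLE (𝕜 := ℝ) (E := ℝ)).toContinuousLinearMap).comp
        s.hasTemperateGrowth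
  · intro x
    simp only [pow_zero, mul_one, invDx]
    exact (norm_integral_le_integral_norm _).trans
      (setIntegral_le_integral hs.norm (Filter.Eventually.of_forall fun _ => norm_nonneg _))

theorem invDx_add (s t : 𝓢(ℝ, ℝ)) (x : ℝ) : invDx (s + t : 𝓢(ℝ, ℝ)) x = invDx s x + invDx t x := by
  have hs : Integrable (s : ℝ → ℝ) volume := s.integrable
  have ht : Integrable (t : ℝ → ℝ) volume := t.integrable
  simpa [invDx] using integral_add hs.integrableOn ht.integrableOn

theorem invDx_smul (c : ℝ) (s : 𝓢(ℝ, ℝ)) (x : ℝ) :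
    invDx (c • s : 𝓢(ℝ, ℝ)) x = c * invDx s x := by
  simp [invDx, integral_const_mul]

/-- The multiplication operator `s ↦ v s`. -/
def mulOp (v : 𝓢(ℝ, ℝ)) : 𝓢(ℝ, ℝ) →ₗ[ℝ] 𝓢(ℝ, ℝ) :=
  (SchwartzMap.smulLeftCLM ℝ (v : ℝ → ℝ)).toLinearMap

theorem mulOp_apply (v s : 𝓢(ℝ, ℝ)) (x : ℝ) : mulOp v s x = v x * s x := by
  simp [mulOp, SchwartzMap.smulLeftCLM_apply_apply v.hasTemperateGrowth]

/-- The operator `s ↦ v ∂⁻¹ s`. -/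
def mulInvDx (v : 𝓢(ℝ, ℝ)) : 𝓢(ℝ, ℝ) →ₗ[ℝ] 𝓢(ℝ, ℝ) where
  toFun s := SchwartzMap.smulLeftCLM ℝ (invDx s) v
  map_add' s t := by
    ext x
    simp only [SchwartzMap.smulLeftCLM_apply_apply (hasTemperateGrowth_invDx _),
      add_apply, smul_eq_mul, invDx_add]
    ring
  map_smul' c s := by
    ext x
    simp only [SchwartzMap.smulLeftCLM_apply_apply (hasTemperateGrowth_invDx _),
      smul_apply, smul_eq_mul, invDx_smul, RingHom.id_apply]
    ring

theorem mulInvDx_apply (v s : 𝓢(ℝ, ℝ)) (x : ℝ) : mulInvDx v s x = v x * invDx s x := by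
  simp [mulInvDx, SchwartzMap.smulLeftCLM_apply_apply (hasTemperateGrowth_invDx s), mul_comm]

/-- `Φ₁(v) = 2(∂ v ∂⁻¹ + v) = 2 v_x ∂⁻¹ + 4 v`. -/
def phi1 (v : 𝓢(ℝ, ℝ)) : 𝓢(ℝ, ℝ) →ₗ[ℝ] 𝓢(ℝ, ℝ) :=
  (2 : ℝ) • mulInvDx (dx v) + (4 : ℝ) • mulOp v

/-- `Φ(u) = Φ₀(u) = ∂² + 2 u_x ∂⁻¹ + 4 u`. -/
def phi0 (u : 𝓢(ℝ, ℝ)) : 𝓢(ℝ, ℝ) →ₗ[ℝ] 𝓢(ℝ, ℝ) :=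
  dx ∘ₗ dx + phi1 u

/-- `M₁(v) = 2(∂ v + v ∂)`. -/
def m1 (v : 𝓢(ℝ, ℝ)) : 𝓢(ℝ, ℝ) →ₗ[ℝ] 𝓢(ℝ, ℝ) :=
  (2 : ℝ) • (dx ∘ₗ mulOp v + mulOp v ∘ₗ dx)

/-- `M(u) = M₀(u) = ∂³ + 2(∂ u + u ∂)`. -/
def m0 (u : 𝓢(ℝ, ℝ)) : 𝓢(ℝ, ℝ) →ₗ[ℝ] 𝓢(ℝ, ℝ) :=
  dx ∘ₗ dx ∘ₗ dx + m1 u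

/-- The vector fields `K_n(u) = Φ(u)^n u_x` of the KdV hierarchy. -/
def kdv (n : ℕ) (u : 𝓢(ℝ, ℝ)) : 𝓢(ℝ, ℝ) := (phi0 u ^ n) (dx u)

/-- `Ψ(u) = ∂² + 4 u - 2 ∂⁻¹ u_x`. -/
def psi (u g : ℝ → ℝ) (x : ℝ) : ℝ :=
  deriv (deriv g) x + 4 * u x * g x - 2 * invDx (fun y => deriv u y * g y) x

/-- `f_n(u) = Ψ(u)^n u`. -/
def fKdV (n : ℕ) (u : ℝ → ℝ) : ℝ → ℝ := (psi u)^[n] u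

/-- The functionals `H̃_n(u) = ∫ H_n dx` with density `H_n(u) = ∫_0^1 u f_n(λ u) dλ`. -/
def hamKdV (n : ℕ) (u : 𝓢(ℝ, ℝ)) : ℝ :=
  ∫ x : ℝ, ∫ l in (0 : ℝ)..1, u x * fKdV n (fun y => l * u y) x

/-- The duality pairing on the scalar phase space. -/
def pair (a s : 𝓢(ℝ, ℝ)) : ℝ := ∫ x : ℝ, a x * s x

/-- The duality pairing on two-component columns. -/
def pair2 (a s : 𝓢(ℝ, ℝ) × 𝓢(ℝ, ℝ)) : ℝ := pair a.1 s.1 + pair a.2 s.2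

/-! ### The non-standard first-order perturbation system -/

/-- The perturbed vector field `K_n + α ε K_n`. -/
def kdvPer (n : ℕ) (α ε : ℝ) (u : 𝓢(ℝ, ℝ)) : 𝓢(ℝ, ℝ) := kdv n u + (α * ε) • kdv n u

/-- The vector field of the first-order perturbation system of `u_t = K_n + α ε K_n`. -/
def nonstdField (n : ℕ) (α : ℝ) : 𝓢(ℝ, ℝ) × 𝓢(ℝ, ℝ) → 𝓢(ℝ, ℝ) × 𝓢(ℝ, ℝ) :=
  perField (kdvPer n α)

/-- The four Hamiltonian operators `Ĵ₁⁽¹⁾, M̂₁⁽¹⁾, Ĵ₁⁽²⁾, M̂₁⁽²⁾`. -/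
def nonstdOps (α : ℝ) : Fin 4 → 𝓢(ℝ, ℝ) × 𝓢(ℝ, ℝ) →
    (𝓢(ℝ, ℝ) × 𝓢(ℝ, ℝ) →ₗ[ℝ] 𝓢(ℝ, ℝ) × 𝓢(ℝ, ℝ)) :=
  ![fun _ => blockOp 0 dx dx 0,
    fun η => blockOp 0 (m0 η.1) (m0 η.1) (m1 η.2),
    fun _ => blockOp 0 dx dx (α • dx),
    fun η => blockOp 0 (m0 η.1) (m0 η.1) (m1 η.2 + α • m0 η.1)]

/-- The four Hamiltonian functionals, in the order of `nonstdOps`: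
`per₁ H̃_n + α H̃_n(η₀)`, `per₁ H̃_{n-1} + α H̃_{n-1}(η₀)`, `per₁ H̃_n`, `per₁ H̃_{n-1}`. -/
def nonstdHams (n : ℕ) (α : ℝ) : Fin 4 → 𝓢(ℝ, ℝ) × 𝓢(ℝ, ℝ) → ℝ :=
  ![fun η => perFunctional (hamKdV n) η + α * hamKdV n η.1,
    fun η => perFunctional (hamKdV (n - 1)) η + α * hamKdV (n - 1) η.1,
    fun η => perFunctional (hamKdV n) η,
    fun η => perFunctional (hamKdV (n - 1)) η]

/-- `Φ̂₁⁽¹⁾(β)`, with rows `(β₀, 0)` and `(β₁, β₀)`. -/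
def phiHat1 (β₀ β₁ : ℝ) (_η : 𝓢(ℝ, ℝ) × 𝓢(ℝ, ℝ)) :
    𝓢(ℝ, ℝ) × 𝓢(ℝ, ℝ) →ₗ[ℝ] 𝓢(ℝ, ℝ) × 𝓢(ℝ, ℝ) :=
  blockOp (β₀ • LinearMap.id) 0 (β₁ • LinearMap.id) (β₀ • LinearMap.id)

/-- `Φ̂₁⁽²⁾(β)`, with rows `(β₀ Φ₀(η₀), 0)` and `(β₀ Φ₁(η₁) + β₁ Φ₀(η₀), β₀ Φ₀(η₀))`. -/
def phiHat2 (β₀ β₁ : ℝ) (η : 𝓢(ℝ, ℝ) × 𝓢(ℝ, ℝ)) :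
    𝓢(ℝ, ℝ) × 𝓢(ℝ, ℝ) →ₗ[ℝ] 𝓢(ℝ, ℝ) × 𝓢(ℝ, ℝ) :=
  blockOp (β₀ • phi0 η.1) 0 (β₀ • phi1 η.2 + β₁ • phi0 η.1) (β₀ • phi0 η.1)

end PerturbedKdV

end

open Filter Topology MeasureTheory
open scoped SchwartzMap

noncomputable section

namespace PerturbedKdV

/-! ### The resolvent recursion in a differential algebra -/

section Algebra

open PowerSeries Finset

/-! The gradients `f_n` should satisfy `∂ f_{n+1} = M(u) f_n`, but solving this for `f_{n+1}` needs
an antiderivative that is again local. The proof starts instead from a first integral of the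
recursion: the series `r = 1 + 2X ∑ f_n Xⁿ` is made to satisfy `r² = X (2 r r'' - r'² + 4 u r²) +
1`, which determines every `f_n` algebraically as a differential polynomial (`resolventSeries_sq`).
Differentiating this identity in `x` returns the recursion. Comparing its variations in `u` and in
`X` shows that `8(n+1) f_n δu` is, modulo total derivatives, the variation of a coefficient of `r +
1/r` (`exists_resolvent_potential`). So `f_n` is the gradient of `H̃_n`, and `K_n = ∂ f_n`, `K_{n+1}
= M f_n`.

For the scalar hierarchy, skew-symmetry of `∂` and `M` gives involution (`pair_gradKdV_dx`);
heredity of `Φ` makes it a recursion operator of every `K_n` and makes the flows commute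
(`phi0_recursion`, `gateaux_kdv_comm`). Linear independence on a dense set follows from the leading
term `u_{2n}` of `f_n` and a determinant that is polynomial along lines
(`dense_linearIndependent_kdv`).

The perturbation system with `α = 0` is the linearised system `(K_n(η₀), K_n'(η₀)[η₁])`, so each
identity needed for it is a scalar identity together with its derivative in the direction `η₁`; the
terms in `α` and `β₁` only add multiples of the undifferentiated identity. The four operators lie in
one linear family `pencil`, so a single verification of the Jacobi identity gives all
compatibilities. The factor `α` may sit in the functional or in the operator, and with the two
operators `∂` and `M` this makes four Hamiltonian forms.

Smoothness is uniform: all fields are built from continuous linear and jointly continuous bilinear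
maps (`IsPolyMap`), a class closed under taking tangent maps. -/

/-- The coefficientwise extension of a derivation to formal power series. -/
def coeffDerivation {A : Type*} [CommRing A] [Algebra ℝ A] (D : Derivation ℝ A A) :
    Derivation ℝ A⟦X⟧ A⟦X⟧ :=
  Derivation.mk'
    { toFun := fun f => PowerSeries.mk fun n => D (coeff n f)
      map_add' := fun f g => by ext n; simp
      map_smul' := fun c f => by ext n; simp }
    (fun f g => by
      ext n
      simp only [LinearMap.coe_mk, AddHom.coe_mk, coeff_mk, coeff_mul, map_sum, map_add,
        smul_eq_mul, Derivation.leibniz, Finset.sum_add_distrib]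
      congr 1
      rw [← Finset.Nat.sum_antidiagonal_swap]
      rfl)

variable {A : Type*} [CommRing A] [Algebra ℝ A]

@[simp]
theorem coeff_coeffDerivation (D : Derivation ℝ A A) (f : A⟦X⟧) (n : ℕ) :
    coeff n (coeffDerivation D f) = D (coeff n f) := by
  simp [coeffDerivation]

@[simp]
theorem coeffDerivation_X (D : Derivation ℝ A A) : coeffDerivation D (X : A⟦X⟧) = 0 := by
  ext n
  simp only [coeff_coeffDerivation, coeff_X]
  split_ifs <;> simp

@[simp]
theorem coeffDerivation_C (D : Derivation ℝ A A) (a : A) :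
    coeffDerivation D (C a) = C (D a) := by
  ext n
  simp only [coeff_coeffDerivation, coeff_C]
  split_ifs <;> simp

theorem coeffDerivation_comm {D δ : Derivation ℝ A A} (h : ∀ a, D (δ a) = δ (D a)) (f : A⟦X⟧) :
    coeffDerivation D (coeffDerivation δ f) = coeffDerivation δ (coeffDerivation D f) := by
  ext n
  simp [h]

theorem coeffDerivation_derivative (D : Derivation ℝ A A) (f : A⟦X⟧) :
    coeffDerivation D (d⁄dX A f) = d⁄dX A (coeffDerivation D f) := by
  ext n
  simp only [coeff_coeffDerivation, coeff_derivative]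
  rw [Derivation.leibniz]
  have : D ((n : A) + 1) = 0 := by
    simp
  rw [this]
  simp [mul_comm]

/-- The coefficients of the resolvent of the KdV hierarchy, as differential polynomials in `u`. -/
def resolvent (D : Derivation ℝ A A) (u : A) : ℕ → A
  | 0 => u
  | 1 => D (D u) + 3 * u ^ 2
  -- These are the coefficients of the quadratic identity for `r`, solved for the newest term; only
  -- products and derivatives of earlier terms occur.
  | n + 2 => D (D (resolvent D u (n + 1))) + 4 * u * resolvent D u (n + 1)
      - ∑ i : Fin (n + 2), resolvent D u i * resolvent D u (n + 1 - i)
      + ∑ i : Fin (n + 1), (2 * resolvent D u i * D (D (resolvent D u (n - i)))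
          - D (resolvent D u i) * D (resolvent D u (n - i))
          + 4 * u * resolvent D u i * resolvent D u (n - i))
  termination_by n => n
  decreasing_by all_goals omega

/-- The generating series of the resolvent, normalised to have constant term `1`. -/
def resolventSeries (D : Derivation ℝ A A) (u : A) : A⟦X⟧ :=
  1 + 2 * X * PowerSeries.mk (resolvent D u)

theorem coeff_succ_resolventSeries (D : Derivation ℝ A A) (u : A) (n : ℕ) :
    coeff (n + 1) (resolventSeries D u) = 2 * resolvent D u n := by
  have h2 : (2 : A⟦X⟧) = C (2 : A) := (map_ofNat C 2).symm
  rw [resolventSeries, map_add, coeff_one, if_neg (by omega), h2, mul_assoc, coeff_C_mul,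
    coeff_succ_X_mul, coeff_mk, zero_add]

theorem coeff_zero_resolventSeries (D : Derivation ℝ A A) (u : A) :
    coeff 0 (resolventSeries D u) = 1 := by
  simp [resolventSeries]

theorem isUnit_resolventSeries (D : Derivation ℝ A A) (u : A) :
    IsUnit (resolventSeries D u) := by
  rw [PowerSeries.isUnit_iff_constantCoeff]
  simp [resolventSeries]

/-- The defining recursion in series form. It is the quadratic identity for `r = 1 + 2XF` after
division by `4X`. -/
theorem mk_resolvent_eq (D : Derivation ℝ A A) (u : A) (F : A⟦X⟧)
    (hF : F = PowerSeries.mk (resolvent D u)) :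
    F = C u + X * (coeffDerivation D (coeffDerivation D F) + 4 * C u * F - F ^ 2)
      + X * (X * (2 * F * coeffDerivation D (coeffDerivation D F) - coeffDerivation D F ^ 2
        + 4 * C u * F ^ 2)) := by
  have h2 : (2 : A⟦X⟧) = C (2 : A) := (map_ofNat C 2).symm
  have h4 : (4 : A⟦X⟧) = C (4 : A) := (map_ofNat C 4).symm
  ext n
  match n with
  | 0 => simp [hF, resolvent]
  | 1 =>
    rw [h2, h4, map_add, map_add, coeff_C, if_neg (by omega), coeff_succ_X_mul, coeff_succ_X_mul,
      coeff_zero_X_mul]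
    simp only [map_add, map_sub, mul_assoc, coeff_coeffDerivation, pow_two, coeff_mul, hF, coeff_mk]
    simp [resolvent]
    ring
  | n + 2 =>
    rw [h2, h4, map_add, map_add, coeff_C, if_neg (by omega), coeff_succ_X_mul, coeff_succ_X_mul,
      coeff_succ_X_mul]
    simp only [mul_assoc, pow_two, map_add, map_sub, coeff_C_mul]
    simp only [coeff_mul, coeff_coeffDerivation, hF, coeff_mk]
    rw [resolvent]
    rw [Finset.Nat.sum_antidiagonal_eq_sum_range_succ
        (fun i j => resolvent D u i * resolvent D u j),
      Finset.Nat.sum_antidiagonal_eq_sum_range_succ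
        (fun i j => resolvent D u i * D (D (resolvent D u j))),
      Finset.Nat.sum_antidiagonal_eq_sum_range_succ
        (fun i j => D (resolvent D u i) * D (resolvent D u j)),
      Finset.Nat.sum_antidiagonal_eq_sum_range_succ
        (fun i j => resolvent D u i * resolvent D u j)]
    simp only [Finset.sum_range, Finset.mul_sum, ← Finset.sum_add_distrib,
      ← Finset.sum_sub_distrib]
    have : ∀ x y z w : A, x = z → y = w → x + y = z + w := fun _ _ _ _ h1 h2 => by rw [h1, h2]
    rw [zero_add]
    refine this _ _ _ _ ?_ ?_
    · ring
    · exact Finset.sum_congr rfl fun i _ => by ring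

/-- The first integral of the third-order linear equation for `r`, with `X` as inverse spectral
parameter and integration constant `1`. -/
theorem resolventSeries_sq (D : Derivation ℝ A A) (u : A) (r : A⟦X⟧)
    (hr : r = resolventSeries D u) :
    r ^ 2 = X * (2 * r * coeffDerivation D (coeffDerivation D r) - coeffDerivation D r ^ 2
      + 4 * C u * r ^ 2) + 1 := by
  obtain ⟨F, hF⟩ : ∃ F, F = PowerSeries.mk (resolvent D u) := ⟨_, rfl⟩
  have h := mk_resolvent_eq D u F hF
  have n2 : coeffDerivation D (2 : A⟦X⟧) = 0 := (coeffDerivation D).map_natCast 2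
  have h1 : coeffDerivation D r = 2 * X * coeffDerivation D F := by
    rw [hr, resolventSeries, ← hF]
    simp only [map_add, Derivation.leibniz, Derivation.map_one_eq_zero, smul_eq_mul,
      coeffDerivation_X, n2]
    ring
  have h2 : coeffDerivation D (coeffDerivation D r)
      = 2 * X * coeffDerivation D (coeffDerivation D F) := by
    rw [h1]
    simp only [Derivation.leibniz, smul_eq_mul, coeffDerivation_X, n2]
    ring
  rw [h2, h1, hr, resolventSeries, ← hF]
  linear_combination (4 * X) * h

/-- Applying `D` to the first integral gives `2r` times the claim, and `2r` is a unit because `r`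
has constant term `1`. -/
theorem resolventSeries_recursion (D : Derivation ℝ A A) (u : A) (r : A⟦X⟧)
    (hr : r = resolventSeries D u) :
    coeffDerivation D r = X * (coeffDerivation D (coeffDerivation D (coeffDerivation D r))
      + 2 * C (D u) * r + 4 * C u * coeffDerivation D r) := by
  have h := congrArg (coeffDerivation D) (resolventSeries_sq D u r hr)
  have h4 : coeffDerivation D (4 : A⟦X⟧) = 0 := (coeffDerivation D).map_natCast 4
  have h2 : coeffDerivation D (2 : A⟦X⟧) = 0 := (coeffDerivation D).map_natCast 2
  simp only [map_add, map_sub, Derivation.leibniz, Derivation.leibniz_pow, smul_eq_mul,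
    coeffDerivation_X, coeffDerivation_C, h4, h2, Derivation.map_one_eq_zero] at h
  have hu : IsUnit ((2 : A⟦X⟧) * r) := by
    refine IsUnit.mul ?_ (hr ▸ isUnit_resolventSeries D u)
    have : IsUnit (algebraMap ℝ A⟦X⟧ 2) := (IsUnit.mk0 (2 : ℝ) two_ne_zero).map _
    rwa [map_ofNat] at this
  refine hu.mul_left_cancel ?_
  simp only [nsmul_eq_mul] at h
  push_cast at h
  linear_combination h

theorem deriv_resolvent_succ (D : Derivation ℝ A A) (u : A) (n : ℕ) :
    D (resolvent D u (n + 1)) = D (D (D (resolvent D u n))) + 2 * D u * resolvent D u n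
      + 4 * u * D (resolvent D u n) := by
  have h := congrArg (coeff (n + 2)) (resolventSeries_recursion D u _ rfl)
  have h2 : (2 : A⟦X⟧) = C (2 : A) := (map_ofNat C 2).symm
  have h4 : (4 : A⟦X⟧) = C (4 : A) := (map_ofNat C 4).symm
  have k2 : ∀ a, D (2 * a) = 2 * D a := fun a => by
    simp [two_mul]
  rw [coeff_succ_X_mul, h2, h4] at h
  simp only [mul_assoc, map_add, coeff_C_mul, coeff_coeffDerivation, coeff_succ_resolventSeries,
    k2] at h
  have hu : IsUnit (2 : A) := by
    have : IsUnit (algebraMap ℝ A 2) := (IsUnit.mk0 (2 : ℝ) two_ne_zero).map _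
    rwa [map_ofNat] at this
  refine hu.mul_left_cancel ?_
  linear_combination h

theorem resolvent_mem {D : Derivation ℝ A A} {u : A} (S : Subalgebra ℝ A) (hu : u ∈ S)
    (hD : ∀ a ∈ S, D a ∈ S) (n : ℕ) : resolvent D u n ∈ S := by
  induction n using Nat.strong_induction_on with
  | _ n ih =>
    have h2 : (2 : A) ∈ S := ofNat_mem S 2
    have h4 : (4 : A) ∈ S := ofNat_mem S 4
    match n with
    | 0 => simpa [resolvent] using hu
    | 1 =>
      rw [resolvent]
      exact S.add_mem (hD _ (hD _ hu)) (S.mul_mem (ofNat_mem S 3) (S.pow_mem hu 2))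
    | n + 2 =>
      rw [resolvent]
      have ih' : ∀ k, k ≤ n + 1 → resolvent D u k ∈ S := fun k hk => ih k (by omega)
      refine S.add_mem (S.sub_mem (S.add_mem (hD _ (hD _ (ih' _ le_rfl)))
        (S.mul_mem (S.mul_mem h4 hu) (ih' _ le_rfl)))
        (S.sum_mem fun i _ => S.mul_mem (ih' _ (by omega)) (ih' _ (by omega))))
        (S.sum_mem fun i _ => ?_)
      have h1 := ih' i (by omega)
      have h3 := ih' (n - i) (by omega)
      exact S.add_mem (S.sub_mem (S.mul_mem (S.mul_mem h2 h1) (hD _ (hD _ h3)))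
        (S.mul_mem (hD _ h1) (hD _ h3))) (S.mul_mem (S.mul_mem (S.mul_mem h4 hu) h1) h3)

theorem coeff_mem_of_mul_eq_one (S : Subalgebra ℝ A) {r s : A⟦X⟧} (h : r * s = 1)
    (h0 : coeff 0 r = 1) (hr : ∀ n, coeff n r ∈ S) (n : ℕ) : coeff n s ∈ S := by
  induction n using Nat.strong_induction_on with
  | _ n ih =>
    have k := congrArg (coeff n) h
    rw [coeff_mul] at k
    match n with
    | 0 =>
      simp only [Finset.Nat.antidiagonal_zero, Finset.sum_singleton, h0, one_mul] at k
      rw [k, coeff_zero_one]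
      exact S.one_mem
    | n + 1 =>
      rw [Finset.Nat.sum_antidiagonal_succ, h0, one_mul, coeff_one, if_neg (by omega)] at k
      rw [eq_neg_of_add_eq_zero_left k]
      refine S.neg_mem (S.sum_mem fun p hp => S.mul_mem (hr _) (ih _ ?_))
      have := Finset.HasAntidiagonal.mem_antidiagonal.1 hp
      omega

/-- Up to a total derivative, `8 (n + 1) f_n δu` is the variation of a differential polynomial
in `u`. -/
theorem exists_resolvent_potential (D : Derivation ℝ A A) (u : A) (n : ℕ) :
    ∃ g : A, (∀ S : Subalgebra ℝ A, u ∈ S → (∀ a ∈ S, D a ∈ S) → g ∈ S) ∧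
      ∀ δ : Derivation ℝ A A, (∀ a, D (δ a) = δ (D a)) →
      ∃ h : A, (8 * (n + 1) : ℝ) • (resolvent D u n * δ u) = δ g + D h := by
  obtain ⟨s, hs⟩ := (isUnit_resolventSeries D u).exists_right_inv
  have hS : ∀ S : Subalgebra ℝ A, u ∈ S → (∀ a ∈ S, D a ∈ S) →
      ∀ k, coeff k (resolventSeries D u) ∈ S := by
    rintro S hu hD (_ | k)
    · rw [coeff_zero_resolventSeries]
      exact S.one_mem
    · rw [coeff_succ_resolventSeries]
      exact S.mul_mem (ofNat_mem S 2) (resolvent_mem S hu hD k)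
  refine ⟨coeff (n + 2) (resolventSeries D u + s), fun S hu hD => ?_, fun δ hδ => ?_⟩
  · rw [map_add]
    exact S.add_mem (hS S hu hD _)
      (coeff_mem_of_mul_eq_one S hs (coeff_zero_resolventSeries D u) (hS S hu hD) _)
  obtain ⟨r, hr⟩ : ∃ r, r = resolventSeries D u := ⟨_, rfl⟩
  rw [← hr] at hs ⊢
  have e := resolventSeries_sq D u r hr
  set D' := coeffDerivation D with hD'
  set δ' := coeffDerivation δ with hδ'
  have cδ : ∀ f, δ' (D' f) = D' (δ' f) := fun f => (coeffDerivation_comm hδ f).symm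
  have ct : ∀ f, d⁄dX A (D' f) = D' (d⁄dX A f) := fun f => (coeffDerivation_derivative D f).symm
  have e1 := congrArg δ' e
  have e2 := congrArg (d⁄dX A) e
  have e3 := congrArg D' hs
  have e4 := congrArg δ' hs
  have n2 : δ' (2 : A⟦X⟧) = 0 := δ'.map_natCast 2
  have n4 : δ' (4 : A⟦X⟧) = 0 := δ'.map_natCast 4
  have m2 : d⁄dX A (2 : A⟦X⟧) = 0 := (d⁄dX A).map_natCast 2
  have m4 : d⁄dX A (4 : A⟦X⟧) = 0 := (d⁄dX A).map_natCast 4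
  have xδ : δ' (X : A⟦X⟧) = 0 := coeffDerivation_X δ
  have uδ : δ' (C u) = C (δ u) := coeffDerivation_C δ u
  simp only [map_add, map_sub, Derivation.leibniz, Derivation.leibniz_pow, smul_eq_mul,
    xδ, uδ, derivative_X, derivative_C, n2, n4, m2, m4, Derivation.map_one_eq_zero, cδ, ct,
    nsmul_eq_mul] at e1 e2 e3 e4
  push_cast at e1 e2
  set W := δ' r * D' (d⁄dX A r) - d⁄dX A r * D' (δ' r) with hW
  -- Generating form of the claim: `r + s` with `s = 1/r` collects the potentials, and the Wronskian
  -- `W` of the variations of `r` in `u` and in `X` gives the total derivative.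
  have key : 4 * X ^ 2 * (d⁄dX A r) * C (δ u) = δ' (r + s) + 2 * X ^ 2 * D' (W * s) := by
    have hW' : D' W = δ' r * D' (D' (d⁄dX A r)) - d⁄dX A r * D' (D' (δ' r)) := by
      simp only [hW, map_sub, Derivation.leibniz, smul_eq_mul]
      ring
    -- Cross-multiplying the two variations of the first integral leaves the explicit `δu`, the
    -- Wronskian terms, and the explicit `X`-derivative; the last is rewritten through `r² - 1` by
    -- the identity itself. Multiplication by `s²` then turns `(1 - s²) δr` into `δ(r + s)`.
    have hp : (r ^ 2 - 1) * δ' r + 2 * X ^ 2 * (r * D' W - D' r * W)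
        = 4 * X ^ 2 * r ^ 2 * (d⁄dX A r) * C (δ u) := by
      rw [hW', hW]
      linear_combination (X * d⁄dX A r) * e1 - (X * δ' r) * e2 + (δ' r) * e
    rw [map_add, Derivation.leibniz, smul_eq_mul, smul_eq_mul]
    have i1 : δ' s = - s ^ 2 * δ' r := by linear_combination s * e4 - δ' s * hs
    have i2 : D' s = - s ^ 2 * D' r := by linear_combination s * e3 - D' s * hs
    rw [i1, i2]
    have hs2 : r ^ 2 * s ^ 2 = 1 := by rw [← mul_pow, hs, one_pow]
    linear_combination (- s ^ 2) * hp + (δ' r - 4 * X ^ 2 * (d⁄dX A r) * C (δ u)) * hs2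
      + 2 * X ^ 2 * D' W * s * hs
  -- In the coefficient of `X^(n+2)`, `d/dX` contributes `n + 1` and `r` contributes `2 f_n`, hence
  -- the factor `4 · 2 (n + 1)`.
  refine ⟨2 * coeff n (W * s), ?_⟩
  have h2 : (2 : A⟦X⟧) = C (2 : A) := (map_ofNat C 2).symm
  have h4 : (4 : A⟦X⟧) = C (4 : A) := (map_ofNat C 4).symm
  have k := congrArg (coeff (n + 2)) key
  have l1 : 4 * X ^ 2 * (d⁄dX A r) * C (δ u) = X * (X * (C 4 * (C (δ u) * d⁄dX A r))) := by
    rw [h4]; ring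
  have l2 : 2 * X ^ 2 * D' (W * s) = X * (X * (C 2 * D' (W * s))) := by
    rw [h2]; ring
  rw [l1, l2, map_add, coeff_succ_X_mul, coeff_succ_X_mul, coeff_succ_X_mul, coeff_succ_X_mul,
    coeff_C_mul, coeff_C_mul, coeff_C_mul, coeff_derivative, hδ', hD', coeff_coeffDerivation,
    coeff_coeffDerivation, hr, coeff_succ_resolventSeries, ← hr] at k
  have k2 : ∀ a, D (2 * a) = 2 * D a := fun a => by simp [two_mul]
  rw [k2, ← k, Algebra.smul_def]
  simp only [map_mul, map_add, map_one, map_natCast, map_ofNat]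
  ring

end Algebra

/-! ### Derivatives of curves -/

section CurveDeriv

variable {E F G : Type*}
  [AddCommGroup E] [Module ℝ E] [TopologicalSpace E]
  [AddCommGroup F] [Module ℝ F] [TopologicalSpace F]
  [AddCommGroup G] [Module ℝ G] [TopologicalSpace G]

theorem HasCurveDeriv.curveDeriv [T2Space F] {c : ℝ → F} {w : F} (h : HasCurveDeriv c w) :
    curveDeriv c = w :=
  Tendsto.limUnder_eq h

theorem HasCurveDeriv.unique [T2Space F] {c : ℝ → F} {v w : F} (h : HasCurveDeriv c v)
    (h' : HasCurveDeriv c w) : v = w :=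
  tendsto_nhds_unique h h'

theorem hasCurveDeriv_const (a : F) : HasCurveDeriv (fun _ : ℝ => a) 0 := by
  simp [HasCurveDeriv, tendsto_const_nhds]

theorem hasCurveDeriv_line (u v : F) : HasCurveDeriv (fun t : ℝ => u + t • v) v := by
  refine (tendsto_const_nhds (x := v)).congr' ?_
  filter_upwards [self_mem_nhdsWithin] with t ht
  simp [smul_smul, inv_mul_cancel₀ (show t ≠ 0 from ht)]

theorem HasCurveDeriv.clm {c : ℝ → F} {w : F} (h : HasCurveDeriv c w) (L : F →L[ℝ] G) :
    HasCurveDeriv (fun t => L (c t)) (L w) := by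
  have := (L.continuous.tendsto w).comp h
  refine this.congr fun t => ?_
  simp

theorem HasCurveDeriv.prodMk {c : ℝ → F} {d : ℝ → G} {v : F} {w : G} (h : HasCurveDeriv c v)
    (h' : HasCurveDeriv d w) : HasCurveDeriv (fun t => (c t, d t)) (v, w) :=
  h.prodMk_nhds h'

theorem HasCurveDeriv.add [IsTopologicalAddGroup F] {c d : ℝ → F} {v w : F} (h : HasCurveDeriv c v)
    (h' : HasCurveDeriv d w) : HasCurveDeriv (fun t => c t + d t) (v + w) := by
  refine (Tendsto.add h h').congr fun t => ?_
  module

theorem HasCurveDeriv.const_smul [ContinuousSMul ℝ F] {c : ℝ → F} {v : F} (h : HasCurveDeriv c v) (a : ℝ) :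
    HasCurveDeriv (fun t => a • c t) (a • v) := by
  refine (Tendsto.const_smul h a).congr fun t => ?_
  module

theorem HasCurveDeriv.neg [ContinuousSMul ℝ F] {c : ℝ → F} {v : F} (h : HasCurveDeriv c v) :
    HasCurveDeriv (fun t => - c t) (- v) := by
  simpa using h.const_smul (-1)

theorem HasCurveDeriv.sub [IsTopologicalAddGroup F] [ContinuousSMul ℝ F] {c d : ℝ → F} {v w : F} (h : HasCurveDeriv c v)
    (h' : HasCurveDeriv d w) : HasCurveDeriv (fun t => c t - d t) (v - w) := by
  simpa [sub_eq_add_neg] using h.add h'.neg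

theorem HasCurveDeriv.tendsto [IsTopologicalAddGroup F] [ContinuousSMul ℝ F] {c : ℝ → F} {v : F} (h : HasCurveDeriv c v) :
    Tendsto c (𝓝[≠] 0) (𝓝 (c 0)) := by
  have h0 : Tendsto (fun t : ℝ => t) (𝓝[≠] 0) (𝓝 0) := tendsto_nhdsWithin_of_tendsto_nhds
    tendsto_id
  have := (h0.smul h).const_add (c 0)
  rw [zero_smul, add_zero] at this
  refine this.congr' ?_
  filter_upwards [self_mem_nhdsWithin] with t ht
  simp [smul_smul, mul_inv_cancel₀ (show t ≠ 0 from ht)]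

/-- The difference quotient splits into `B` of the quotient of `c` with `d t`, plus `B` of `c 0`
with the quotient of `d`; joint continuity of `B` passes to the limit in both. -/
theorem HasCurveDeriv.bilin [IsTopologicalAddGroup G] [ContinuousSMul ℝ G] {H : Type*}
    [AddCommGroup H] [Module ℝ H] [TopologicalSpace H] [IsTopologicalAddGroup H]
    {B : F →ₗ[ℝ] G →ₗ[ℝ] H}
    (hB : Continuous fun p : F × G => B p.1 p.2) {c : ℝ → F} {d : ℝ → G} {v : F} {w : G}
    (h : HasCurveDeriv c v) (h' : HasCurveDeriv d w) :
    HasCurveDeriv (fun t => B (c t) (d t)) (B v (d 0) + B (c 0) w) := by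
  have h1 := (hB.tendsto (v, d 0)).comp (h.prodMk_nhds h'.tendsto)
  have h2 := (hB.tendsto (c 0, w)).comp ((tendsto_const_nhds (x := c 0)).prodMk_nhds h')
  refine (h1.add h2).congr fun t => ?_
  simp only [Function.comp, map_smul, map_sub, LinearMap.smul_apply, LinearMap.sub_apply]
  module

theorem gateaux_eq_of_hasCurveDeriv {E F : Type*} [AddCommGroup E] [Module ℝ E]
    [AddCommGroup F] [Module ℝ F] [TopologicalSpace F] [T2Space F] {X : E → F} {u v : E} {w : F}
    (h : HasCurveDeriv (fun t : ℝ => X (u + t • v)) w) : gateaux X u v = w :=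
  h.curveDeriv

theorem IsSmooth.clm {X : E → F} (hX : IsSmooth X) (L : F →L[ℝ] G) :
    IsSmooth fun u => L (X u) := by
  obtain ⟨D, h0, h1, h2⟩ := hX
  exact ⟨fun k u v => L (D k u v), fun u v => by simp only [h0], fun k => L.continuous.comp (h1 k),
    fun k u v w => (h2 k u v w).clm L⟩

theorem IsSmooth.prodMk {X : E → F} {Y : E → G} (hX : IsSmooth X) (hY : IsSmooth Y) :
    IsSmooth fun u => (X u, Y u) := by
  obtain ⟨D, h0, h1, h2⟩ := hX
  obtain ⟨D', h0', h1', h2'⟩ := hY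
  exact ⟨fun k u v => (D k u v, D' k u v), fun u v => by simp only [h0, h0'],
    fun k => (h1 k).prodMk (h1' k), fun k u v w => (h2 k u v w).prodMk (h2' k u v w)⟩

end CurveDeriv

/-! ### Polynomial maps into the Schwartz space -/

section PolyMap

/-- The second Gateaux derivative `X''(u)[v, w]`. -/
def hess {E F : Type*} [AddCommGroup E] [Module ℝ E] [AddCommGroup F] [Module ℝ F]
    [TopologicalSpace F] (X : E → F) (u v w : E) : F :=
  gateaux (fun u' => gateaux X u' v) u w

/-- Maps into the Schwartz space built from continuous linear maps by sums, continuous linear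
maps and jointly continuous bilinear maps. -/
inductive IsPolyMap {E : Type*} [AddCommGroup E] [Module ℝ E] [TopologicalSpace E] :
    (E → 𝓢(ℝ, ℝ)) → Prop
  | clm (L : E →L[ℝ] 𝓢(ℝ, ℝ)) : IsPolyMap fun u => L u
  | add {X Y : E → 𝓢(ℝ, ℝ)} : IsPolyMap X → IsPolyMap Y → IsPolyMap fun u => X u + Y u
  | comp (L : 𝓢(ℝ, ℝ) →L[ℝ] 𝓢(ℝ, ℝ)) {X : E → 𝓢(ℝ, ℝ)} : IsPolyMap X →
      IsPolyMap fun u => L (X u)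
  | bilin {B : 𝓢(ℝ, ℝ) →ₗ[ℝ] 𝓢(ℝ, ℝ) →ₗ[ℝ] 𝓢(ℝ, ℝ)}
      (hB : Continuous fun p : 𝓢(ℝ, ℝ) × 𝓢(ℝ, ℝ) => B p.1 p.2) {X Y : E → 𝓢(ℝ, ℝ)} :
      IsPolyMap X → IsPolyMap Y → IsPolyMap fun u => B (X u) (Y u)

namespace IsPolyMap

variable {E E' : Type*} [AddCommGroup E] [Module ℝ E] [TopologicalSpace E]
  [AddCommGroup E'] [Module ℝ E'] [TopologicalSpace E']

theorem precomp {X : E → 𝓢(ℝ, ℝ)} (hX : IsPolyMap X) (L : E' →L[ℝ] E) :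
    IsPolyMap fun u => X (L u) := by
  induction hX with
  | clm M => exact .clm (M.comp L)
  | add _ _ h1 h2 => exact .add h1 h2
  | comp M _ h => exact .comp M h
  | bilin hB _ _ h1 h2 => exact .bilin hB h1 h2

theorem smul {X : E → 𝓢(ℝ, ℝ)} (hX : IsPolyMap X) (c : ℝ) : IsPolyMap fun u => c • X u :=
  .comp (c • ContinuousLinearMap.id ℝ _) hX

theorem zero : IsPolyMap fun _ : E => (0 : 𝓢(ℝ, ℝ)) :=
  .clm 0

theorem continuous {X : E → 𝓢(ℝ, ℝ)} (hX : IsPolyMap X) : Continuous X := by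
  induction hX with
  | clm M => exact M.continuous
  | add _ _ h1 h2 => exact h1.add h2
  | comp M _ h => exact M.continuous.comp h
  | bilin hB _ _ h1 h2 => exact hB.comp (h1.prodMk h2)

/-- One induction carries the tangent map, the symmetric second derivative and the chain rules. The
rules are stated along arbitrary differentiable curves so that the bilinear case can apply the
product rule to the two factors. -/
theorem exists_tangent {X : E → 𝓢(ℝ, ℝ)} (hX : IsPolyMap X) :
    ∃ (dX : E → E →ₗ[ℝ] 𝓢(ℝ, ℝ)) (d2X : E → E → E → 𝓢(ℝ, ℝ)),
      IsPolyMap (fun p : E × E => dX p.1 p.2) ∧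
      (∀ (c : ℝ → E) (w : E), HasCurveDeriv c w →
        HasCurveDeriv (fun t => X (c t)) (dX (c 0) w)) ∧
      (∀ u v w, d2X u v w = d2X u w v) ∧
      (∀ u v, d2X u 0 v = 0) ∧
      (∀ (c d : ℝ → E) (a b : E), HasCurveDeriv c a → HasCurveDeriv d b →
        HasCurveDeriv (fun t => dX (c t) (d t)) (d2X (c 0) (d 0) a + dX (c 0) b)) := by
  induction hX with
  | clm L =>
    refine ⟨fun _ => L.toLinearMap, fun _ _ _ => 0, .clm (L.comp (.snd ℝ E E)),
      fun c w h => h.clm L, fun _ _ _ => rfl, fun _ _ => rfl, fun c d a b _ h => ?_⟩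
    rw [zero_add]
    exact h.clm L
  | @add X Y _ _ h1 h2 =>
    obtain ⟨dX, d2X, hX1, hX2, hX3, hX4, hX5⟩ := h1
    obtain ⟨dY, d2Y, hY1, hY2, hY3, hY4, hY5⟩ := h2
    refine ⟨fun u => dX u + dY u, fun u v w => d2X u v w + d2Y u v w, .add hX1 hY1,
      fun c w h => (hX2 c w h).add (hY2 c w h), fun u v w => by simp only [hX3 u v, hY3 u v],
      fun u v => by simp only [hX4, hY4, add_zero], fun c d a b hc hd => ?_⟩
    have := (hX5 c d a b hc hd).add (hY5 c d a b hc hd)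
    rw [LinearMap.add_apply, add_add_add_comm]
    exact this
  | @comp L X _ h =>
    obtain ⟨dX, d2X, hX1, hX2, hX3, hX4, hX5⟩ := h
    refine ⟨fun u => L.toLinearMap ∘ₗ dX u, fun u v w => L (d2X u v w), .comp L hX1,
      fun c w h => (hX2 c w h).clm L, fun u v w => by simp only [hX3 u v],
      fun u v => by simp only [hX4, map_zero], fun c d a b hc hd => ?_⟩
    have := (hX5 c d a b hc hd).clm L
    rwa [map_add] at this
  | @bilin B hB X Y hX hY h1 h2 =>
    obtain ⟨dX, d2X, hX1, hX2, hX3, hX4, hX5⟩ := h1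
    obtain ⟨dY, d2Y, hY1, hY2, hY3, hY4, hY5⟩ := h2
    refine ⟨fun u => (B.flip (Y u)) ∘ₗ dX u + (B (X u)) ∘ₗ dY u,
      fun u v w => B (d2X u v w) (Y u) + B (dX u v) (dY u w) + B (dX u w) (dY u v)
        + B (X u) (d2Y u v w), ?_, fun c w h => (hX2 c w h).bilin hB (hY2 c w h),
      fun u v w => ?_, fun u v => ?_, fun c d a b hc hd => ?_⟩
    · exact .add (.bilin hB hX1 (hY.precomp (.fst ℝ E E)))
        (.bilin hB (hX.precomp (.fst ℝ E E)) hY1)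
    · dsimp only
      rw [hX3, hY3]
      abel
    · simp only [hX4, hY4, map_zero, LinearMap.zero_apply, add_zero]
    · have k1 := (hX5 c d a b hc hd).bilin hB (hY2 c a hc)
      have k2 := (hX2 c a hc).bilin hB (hY5 c d a b hc hd)
      have k := k1.add k2
      refine (congrArg (HasCurveDeriv _) ?_).mp k
      simp only [map_add, LinearMap.add_apply, LinearMap.comp_apply, LinearMap.flip_apply]
      abel

variable {X : E → 𝓢(ℝ, ℝ)}

theorem exists_gateaux_eq (hX : IsPolyMap X) :
    ∃ dX : E → E →ₗ[ℝ] 𝓢(ℝ, ℝ), (∀ u v, gateaux X u v = dX u v) ∧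
      IsPolyMap (fun p : E × E => dX p.1 p.2) ∧
      (∀ (c : ℝ → E) (w : E), HasCurveDeriv c w →
        HasCurveDeriv (fun t => X (c t)) (dX (c 0) w)) ∧
      (∀ u v w, hess X u v w = hess X u w v) ∧
      (∀ (c d : ℝ → E) (a b : E), HasCurveDeriv c a → HasCurveDeriv d b →
        HasCurveDeriv (fun t => dX (c t) (d t)) (hess X (c 0) (d 0) a + dX (c 0) b)) := by
  obtain ⟨dX, d2X, h1, h2, h3, h4, h5⟩ := hX.exists_tangent
  have hg : ∀ u v, gateaux X u v = dX u v := fun u v => by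
    have := h2 _ _ (hasCurveDeriv_line u v)
    rw [zero_smul, add_zero] at this
    exact gateaux_eq_of_hasCurveDeriv this
  have hh : ∀ u v w, hess X u v w = d2X u v w := fun u v w => by
    have := h5 _ _ _ _ (hasCurveDeriv_line u w) (hasCurveDeriv_const v)
    rw [zero_smul, add_zero, map_zero, add_zero] at this
    simp only [hess, hg]
    exact gateaux_eq_of_hasCurveDeriv this
  refine ⟨dX, hg, h1, h2, fun u v w => by rw [hh, hh, h3], fun c d a b hc hd => ?_⟩
  rw [hh]
  exact h5 c d a b hc hd

theorem tangent (hX : IsPolyMap X) : IsPolyMap fun p : E × E => gateaux X p.1 p.2 := by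
  obtain ⟨dX, hg, h1, -⟩ := hX.exists_gateaux_eq
  simpa only [hg] using h1

theorem gateaux_add (hX : IsPolyMap X) (u v w : E) :
    gateaux X u (v + w) = gateaux X u v + gateaux X u w := by
  obtain ⟨dX, hg, -⟩ := hX.exists_gateaux_eq
  simp only [hg, map_add]

theorem gateaux_smul (hX : IsPolyMap X) (u v : E) (t : ℝ) :
    gateaux X u (t • v) = t • gateaux X u v := by
  obtain ⟨dX, hg, -⟩ := hX.exists_gateaux_eq
  simp only [hg, map_smul]

theorem hasCurveDeriv_comp (hX : IsPolyMap X) {c : ℝ → E} {w : E} (h : HasCurveDeriv c w) :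
    HasCurveDeriv (fun t => X (c t)) (gateaux X (c 0) w) := by
  obtain ⟨dX, hg, -, h2, -⟩ := hX.exists_gateaux_eq
  simpa only [hg] using h2 c w h

theorem hasCurveDeriv (hX : IsPolyMap X) (u v : E) :
    HasCurveDeriv (fun t : ℝ => X (u + t • v)) (gateaux X u v) := by
  simpa using hX.hasCurveDeriv_comp (hasCurveDeriv_line u v)

theorem hess_comm (hX : IsPolyMap X) (u v w : E) : hess X u v w = hess X u w v := by
  obtain ⟨dX, -, -, -, h3, -⟩ := hX.exists_gateaux_eq
  exact h3 u v w

theorem hasCurveDeriv_gateaux (hX : IsPolyMap X) {c d : ℝ → E} {a b : E}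
    (hc : HasCurveDeriv c a) (hd : HasCurveDeriv d b) :
    HasCurveDeriv (fun t => gateaux X (c t) (d t))
      (hess X (c 0) (d 0) a + gateaux X (c 0) b) := by
  obtain ⟨dX, hg, -, -, -, h4⟩ := hX.exists_gateaux_eq
  simpa only [hg] using h4 c d a b hc hd

theorem gateaux_zero (hX : IsPolyMap X) (u : E) : gateaux X u 0 = 0 := by
  simpa using hX.gateaux_smul u 0 0

theorem hess_smul (hX : IsPolyMap X) (u v w : E) (t : ℝ) :
    hess X u v (t • w) = t • hess X u v w := by
  rw [hX.hess_comm u v (t • w), hX.hess_comm u v w]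
  have h1 := hX.hasCurveDeriv_gateaux (hasCurveDeriv_line u v) (hasCurveDeriv_const (t • w))
  have h2 := (hX.hasCurveDeriv_gateaux (hasCurveDeriv_line u v)
    (hasCurveDeriv_const w)).const_smul t
  simp only [hX.gateaux_smul] at h1
  have h3 := h1.unique h2
  simpa only [zero_smul, add_zero, hX.gateaux_zero] using h3

/-- The next derivative is the tangent map of `Y`, regarded as a map on the product space, in the
direction `(w, 0)`. It is again polynomial, so the construction iterates to all orders. -/
theorem exists_next {k : ℕ} (Y : E → (Fin k → E) → 𝓢(ℝ, ℝ))
    (hY : IsPolyMap fun p : E × (Fin k → E) => Y p.1 p.2) :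
    ∃ Z : E → (Fin (k + 1) → E) → 𝓢(ℝ, ℝ),
      IsPolyMap (fun p : E × (Fin (k + 1) → E) => Z p.1 p.2) ∧
      ∀ u v w, HasCurveDeriv (fun t : ℝ => Y (u + t • w) v) (Z u (Fin.cons w v)) := by
  let Y' : E × (Fin k → E) → 𝓢(ℝ, ℝ) := fun p => Y p.1 p.2
  refine ⟨fun u v => gateaux Y' (u, Fin.tail v) (v 0, 0), ?_, fun u v w => ?_⟩
  · let T : (E × (Fin (k + 1) → E)) →L[ℝ] (Fin k → E) :=
      ContinuousLinearMap.pi fun i => (ContinuousLinearMap.proj i.succ).comp (.snd ℝ _ _)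
    let S : (E × (Fin (k + 1) → E)) →L[ℝ] E :=
      (ContinuousLinearMap.proj 0).comp (.snd ℝ E (Fin (k + 1) → E))
    exact hY.tangent.precomp (((ContinuousLinearMap.fst ℝ _ _).prod T).prod (S.prod 0))
  · have := IsPolyMap.hasCurveDeriv (X := Y') hY (u, v) (w, 0)
    simpa [Y'] using this

theorem isSmooth (hX : IsPolyMap X) : IsSmooth X := by
  choose! next h1 h2 using fun k => exists_next (E := E) (k := k)
  let D : (k : ℕ) → {Y : E → (Fin k → E) → 𝓢(ℝ, ℝ) //
      IsPolyMap fun p : E × (Fin k → E) => Y p.1 p.2} :=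
    Nat.rec ⟨fun u _ => X u, hX.precomp (.fst ℝ E (Fin 0 → E))⟩
      fun k Y => ⟨next k Y.1, h1 k Y.1 Y.2⟩
  exact ⟨fun k => (D k).1, fun _ _ => rfl, fun k => (D k).2.continuous,
    fun k => h2 k (D k).1 (D k).2⟩

end IsPolyMap

end PolyMap

/-! ### Continuity of multiplication -/

section Continuity

theorem dx_apply (s : 𝓢(ℝ, ℝ)) (x : ℝ) : dx s x = deriv s x := rfl

theorem hasDerivAt_dx (s : 𝓢(ℝ, ℝ)) (x : ℝ) : HasDerivAt s (dx s x) x :=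
  s.hasDerivAt x

theorem dx_mulOp (f g : 𝓢(ℝ, ℝ)) : dx (mulOp f g) = mulOp (dx f) g + mulOp f (dx g) := by
  ext x
  have h : (mulOp f g : ℝ → ℝ) = fun y => f y * g y := funext (mulOp_apply f g)
  rw [dx_apply, h, ((hasDerivAt_dx f x).fun_mul (hasDerivAt_dx g x)).deriv]
  simp [mulOp_apply]

theorem dx_mulInvDx (f g : 𝓢(ℝ, ℝ)) :
    dx (mulInvDx f g) = mulInvDx (dx f) g + mulOp f g := by
  ext x
  have h : (mulInvDx f g : ℝ → ℝ) = fun y => f y * invDx g y := funext (mulInvDx_apply f g)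
  rw [dx_apply, h, ((hasDerivAt_dx f x).fun_mul (hasDerivAt_invDx g x)).deriv]
  simp [mulOp_apply, mulInvDx_apply]

/-- Multiplication as a bilinear map. -/
def mulBilin : 𝓢(ℝ, ℝ) →ₗ[ℝ] 𝓢(ℝ, ℝ) →ₗ[ℝ] 𝓢(ℝ, ℝ) :=
  LinearMap.mk₂ ℝ (fun f g => mulOp f g)
    (fun f f' g => by ext x; simp [mulOp_apply, add_mul])
    (fun c f g => by ext x; simp [mulOp_apply, mul_assoc])
    (fun f g g' => map_add _ _ _) (fun c f g => map_smul _ _ _)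

/-- `(f, g) ↦ f ∂⁻¹ g` as a bilinear map. -/
def mulInvDxBilin : 𝓢(ℝ, ℝ) →ₗ[ℝ] 𝓢(ℝ, ℝ) →ₗ[ℝ] 𝓢(ℝ, ℝ) :=
  LinearMap.mk₂ ℝ (fun f g => mulInvDx f g)
    (fun f f' g => by ext x; simp [mulInvDx_apply, add_mul])
    (fun c f g => by ext x; simp [mulInvDx_apply, mul_assoc])
    (fun f g g' => map_add _ _ _) (fun c f g => map_smul _ _ _)

theorem mulBilin_apply (f g : 𝓢(ℝ, ℝ)) : mulBilin f g = mulOp f g := rfl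

theorem mulInvDxBilin_apply (f g : 𝓢(ℝ, ℝ)) : mulInvDxBilin f g = mulInvDx f g := rfl

theorem seminorm_succ (k n : ℕ) (f : 𝓢(ℝ, ℝ)) :
    SchwartzMap.seminorm ℝ k (n + 1) f ≤ SchwartzMap.seminorm ℝ k n (dx f) := by
  refine SchwartzMap.seminorm_le_bound' ℝ k (n + 1) f (apply_nonneg _ _) fun x => ?_
  have := SchwartzMap.le_seminorm' ℝ k n (dx f) x
  rwa [show (dx f : ℝ → ℝ) = deriv f from rfl, ← iteratedDeriv_succ'] at this

/-- The bilinear map `B` is bounded with respect to the `n`-th derivative seminorms. -/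
def IsBoundedBilin (n : ℕ) (B : 𝓢(ℝ, ℝ) →ₗ[ℝ] 𝓢(ℝ, ℝ) →ₗ[ℝ] 𝓢(ℝ, ℝ)) : Prop :=
  ∀ k, ∃ q : 𝓢(ℝ, ℝ) → ℝ, Continuous q ∧ q 0 = 0 ∧ (∀ f, 0 ≤ q f) ∧
    ∀ f g, SchwartzMap.seminorm ℝ k n (B f g) ≤ q f * q g

theorem continuous_seminorm (k n : ℕ) :
    Continuous (SchwartzMap.seminorm ℝ k n : Seminorm ℝ 𝓢(ℝ, ℝ)) :=
  (schwartz_withSeminorms ℝ ℝ ℝ).continuous_seminorm (k, n)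

theorem continuous_of_isBoundedBilin {B : 𝓢(ℝ, ℝ) →ₗ[ℝ] 𝓢(ℝ, ℝ) →ₗ[ℝ] 𝓢(ℝ, ℝ)}
    (hB : ∀ n, IsBoundedBilin n B) :
    Continuous fun p : 𝓢(ℝ, ℝ) × 𝓢(ℝ, ℝ) => B p.1 p.2 := by
  rw [continuous_iff_continuousAt]
  rintro ⟨f₀, g₀⟩
  refine ((schwartz_withSeminorms ℝ ℝ ℝ).tendsto_nhds _ _).2 ?_
  rintro ⟨k, n⟩ ε hε
  obtain ⟨q, hq, hq0, hqn, hb⟩ := hB n k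
  have hlim : Tendsto (fun p : 𝓢(ℝ, ℝ) × 𝓢(ℝ, ℝ) =>
      q (p.1 - f₀) * q (p.2 - g₀) + q (p.1 - f₀) * q g₀ + q f₀ * q (p.2 - g₀))
      (𝓝 (f₀, g₀)) (𝓝 0) := by
    have : Continuous (fun p : 𝓢(ℝ, ℝ) × 𝓢(ℝ, ℝ) =>
      q (p.1 - f₀) * q (p.2 - g₀) + q (p.1 - f₀) * q g₀ + q f₀ * q (p.2 - g₀)) := by
      fun_prop
    have h := this.tendsto (f₀, g₀)
    simpa [hq0] using h
  filter_upwards [hlim.eventually (gt_mem_nhds hε)] with p hp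
  refine lt_of_le_of_lt ?_ hp
  have e : B p.1 p.2 - B f₀ g₀
      = B (p.1 - f₀) (p.2 - g₀) + B (p.1 - f₀) g₀ + B f₀ (p.2 - g₀) := by
    simp only [map_sub, LinearMap.sub_apply]
    abel
  change SchwartzMap.seminorm ℝ k n (B p.1 p.2 - B f₀ g₀) ≤ _
  rw [e]
  refine (map_add_le_add _ _ _).trans (add_le_add ((map_add_le_add _ _ _).trans
    (add_le_add (hb _ _) (hb _ _))) (hb _ _))

/-- Induction on the number of derivatives by the Leibniz rule; without derivatives, the weight goes
on one factor and the other is bounded by its supremum. -/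
theorem isBoundedBilin_mulBilin (n : ℕ) : IsBoundedBilin n mulBilin := by
  induction n with
  | zero =>
    intro k
    refine ⟨fun f => SchwartzMap.seminorm ℝ k 0 f + SchwartzMap.seminorm ℝ 0 0 f,
      (continuous_seminorm k 0).add (continuous_seminorm 0 0), by simp, fun f => by positivity,
      fun f g => ?_⟩
    refine SchwartzMap.seminorm_le_bound' ℝ k 0 _ (by positivity) fun x => ?_
    have h1 := SchwartzMap.le_seminorm' ℝ k 0 f x
    have h2 := SchwartzMap.le_seminorm' ℝ 0 0 g x
    have h3 : 0 ≤ SchwartzMap.seminorm ℝ 0 0 f := apply_nonneg _ _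
    have h4 : 0 ≤ SchwartzMap.seminorm ℝ k 0 g := apply_nonneg _ _
    simp only [iteratedDeriv_zero, pow_zero, one_mul] at h1 h2 ⊢
    rw [mulBilin_apply, mulOp_apply, norm_mul, ← mul_assoc]
    refine mul_le_mul (by linarith) (by linarith) (norm_nonneg _) (by positivity)
  | succ n ih =>
    intro k
    obtain ⟨q, hq, hq0, hqn, hb⟩ := ih k
    refine ⟨fun f => q f + q (dx f),
      hq.add (hq.comp (SchwartzMap.derivCLM ℝ ℝ).continuous), by simp [hq0],
      fun f => add_nonneg (hqn _) (hqn _), fun f g => ?_⟩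
    refine (seminorm_succ k n _).trans ?_
    rw [mulBilin_apply, dx_mulOp]
    refine (map_add_le_add _ _ _).trans ?_
    have h1 := hb (dx f) g
    have h2 := hb f (dx g)
    simp only [mulBilin_apply] at h1 h2
    nlinarith [mul_nonneg (hqn f) (hqn g), mul_nonneg (hqn (dx f)) (hqn (dx g))]

/-- Without derivatives, `∂⁻¹ g` is bounded by the `L¹` norm of `g`. Each derivative gives `∂(f ∂⁻¹
g) = f_x ∂⁻¹ g + f g`, whose last term is an ordinary product. -/
theorem isBoundedBilin_mulInvDxBilin (n : ℕ) : IsBoundedBilin n mulInvDxBilin := by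
  induction n with
  | zero =>
    intro k
    let I : 𝓢(ℝ, ℝ) →L[ℝ] Lp ℝ 1 (volume : Measure ℝ) := SchwartzMap.toLpCLM ℝ ℝ 1 volume
    refine ⟨fun f => SchwartzMap.seminorm ℝ k 0 f + ‖I f‖,
      (continuous_seminorm k 0).add I.continuous.norm, by simp, fun f => by positivity,
      fun f g => ?_⟩
    refine SchwartzMap.seminorm_le_bound' ℝ k 0 _ (by positivity) fun x => ?_
    have h1 := SchwartzMap.le_seminorm' ℝ k 0 f x
    have h2 : ‖invDx g x‖ ≤ ‖I g‖ := by
      have : ‖I g‖ = ∫ y, ‖g y‖ := SchwartzMap.norm_toLp_one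
      rw [this]
      exact (norm_integral_le_integral_norm _).trans
        (setIntegral_le_integral g.integrable.norm (Eventually.of_forall fun _ => norm_nonneg _))
    have h4 : 0 ≤ SchwartzMap.seminorm ℝ k 0 g := apply_nonneg _ _
    have h5 := norm_nonneg (I f)
    simp only [iteratedDeriv_zero] at h1 ⊢
    rw [mulInvDxBilin_apply, mulInvDx_apply, norm_mul, ← mul_assoc]
    refine mul_le_mul (by linarith) (by linarith) (norm_nonneg _) (by positivity)
  | succ n ih =>
    intro k
    obtain ⟨q, hq, hq0, hqn, hb⟩ := ih k
    obtain ⟨q', hq', hq0', hqn', hb'⟩ := isBoundedBilin_mulBilin n k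
    refine ⟨fun f => q f + q (dx f) + q' f,
      (hq.add (hq.comp (SchwartzMap.derivCLM ℝ ℝ).continuous)).add hq', by simp [hq0, hq0'],
      fun f => add_nonneg (add_nonneg (hqn _) (hqn _)) (hqn' _), fun f g => ?_⟩
    refine (seminorm_succ k n _).trans ?_
    rw [mulInvDxBilin_apply, dx_mulInvDx]
    refine (map_add_le_add _ _ _).trans ?_
    have h1 := hb (dx f) g
    have h2 := hb' f g
    simp only [mulBilin_apply, mulInvDxBilin_apply] at h1 h2
    have := hqn f; have := hqn g; have := hqn (dx f); have := hqn (dx g)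
    have := hqn' f; have := hqn' g
    have e : 0 ≤ (q f + q (dx f) + q' f) * (q g + q (dx g) + q' g)
        - (q (dx f) * q g + q' f * q' g) := by
      ring_nf
      positivity
    linarith

theorem continuous_mulBilin :
    Continuous fun p : 𝓢(ℝ, ℝ) × 𝓢(ℝ, ℝ) => mulBilin p.1 p.2 :=
  continuous_of_isBoundedBilin isBoundedBilin_mulBilin

theorem continuous_mulInvDxBilin :
    Continuous fun p : 𝓢(ℝ, ℝ) × 𝓢(ℝ, ℝ) => mulInvDxBilin p.1 p.2 :=
  continuous_of_isBoundedBilin isBoundedBilin_mulInvDxBilin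

namespace IsPolyMap

variable {E : Type*} [AddCommGroup E] [Module ℝ E] [TopologicalSpace E]
  {X Y : E → 𝓢(ℝ, ℝ)}

theorem dx (hX : IsPolyMap X) : IsPolyMap fun u => dx (X u) :=
  .comp (SchwartzMap.derivCLM ℝ ℝ) hX

theorem mulOp (hX : IsPolyMap X) (hY : IsPolyMap Y) : IsPolyMap fun u => mulOp (X u) (Y u) :=
  .bilin continuous_mulBilin hX hY

end IsPolyMap

end Continuity

/-! ### Differential polynomials and their evaluation -/

section Jets

open MvPolynomial

/-- Differential polynomials in two functions: `X (i, k)` is the `k`-th derivative of the `i`-th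
function. -/
abbrev DiffPoly : Type := MvPolynomial (Fin 2 × ℕ) ℝ

/-- The total derivative. -/
def totalD : Derivation ℝ DiffPoly DiffPoly :=
  mkDerivation ℝ fun i => X (i.1, i.2 + 1)

/-- The variation of the first function in the direction of the second. -/
def varD : Derivation ℝ DiffPoly DiffPoly :=
  mkDerivation ℝ fun i => if i.1 = 0 then X (1, i.2) else 0

theorem totalD_X (i : Fin 2 × ℕ) : totalD (X i) = X (i.1, i.2 + 1) :=
  mkDerivation_X _ _ _

theorem varD_X (i : Fin 2 × ℕ) : varD (X i) = if i.1 = 0 then X (1, i.2) else 0 :=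
  mkDerivation_X _ _ _

theorem totalD_varD (p : DiffPoly) : totalD (varD p) = varD (totalD p) := by
  have h : ⁅totalD, varD⁆ = 0 := by
    refine derivation_ext fun i => ?_
    rw [Derivation.commutator_apply, varD_X, totalD_X, varD_X]
    split_ifs <;> simp [totalD_X]
  have := congrArg (fun d => d p) h
  simpa [Derivation.commutator_apply, sub_eq_zero] using this

theorem constantCoeff_derivation {σ : Type*} (d : Derivation ℝ (MvPolynomial σ ℝ)
    (MvPolynomial σ ℝ)) (h : ∀ i, constantCoeff (d (X i)) = 0) (p : MvPolynomial σ ℝ) :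
    constantCoeff (d p) = 0 := by
  induction p using MvPolynomial.induction_on with
  | C a => simp
  | add p q hp hq => simp [hp, hq]
  | mul_X p i hp => simp [Derivation.leibniz, h, hp]

theorem constantCoeff_totalD (p : DiffPoly) : constantCoeff (totalD p) = 0 :=
  constantCoeff_derivation _ (fun i => by simp [totalD_X]) p

theorem constantCoeff_varD (p : DiffPoly) : constantCoeff (varD p) = 0 :=
  constantCoeff_derivation _ (fun i => by rw [varD_X]; split_ifs <;> simp) p

theorem hasDerivAt_aeval {σ : Type*} (d : Derivation ℝ (MvPolynomial σ ℝ) (MvPolynomial σ ℝ))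
    (c : ℝ → σ → ℝ) (t : ℝ) (h : ∀ i, HasDerivAt (fun s => c s i) (aeval (c t) (d (X i))) t)
    (p : MvPolynomial σ ℝ) :
    HasDerivAt (fun s => aeval (c s) p) (aeval (c t) (d p)) t := by
  induction p using MvPolynomial.induction_on with
  | C a => simpa using hasDerivAt_const t a
  | add p q hp hq => simpa only [map_add] using hp.fun_add hq
  | mul_X p i hp =>
    have := hp.fun_mul (h i)
    simp only [map_mul, aeval_X, Derivation.leibniz, smul_eq_mul, map_add]
    refine this.congr_deriv ?_
    ring

/-- The jets of a pair of functions at `x`. -/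
def jet (w : 𝓢(ℝ, ℝ) × 𝓢(ℝ, ℝ)) (x : ℝ) (i : Fin 2 × ℕ) : ℝ :=
  if i.1 = 0 then (dx ^ i.2) w.1 x else (dx ^ i.2) w.2 x

theorem isPolyMap_dx_pow (k : ℕ) : IsPolyMap fun u : 𝓢(ℝ, ℝ) => (dx ^ k) u := by
  induction k with
  | zero => exact .clm (.id ℝ _)
  | succ k ih => simpa only [pow_succ', Module.End.mul_apply] using ih.dx

theorem hasDerivAt_jet (w : 𝓢(ℝ, ℝ) × 𝓢(ℝ, ℝ)) (x : ℝ) (i : Fin 2 × ℕ) :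
    HasDerivAt (fun y => jet w y i) (jet w x (i.1, i.2 + 1)) x := by
  simp only [jet, pow_succ', Module.End.mul_apply]
  split_ifs
  · exact hasDerivAt_dx _ x
  · exact hasDerivAt_dx _ x

/-- A nonzero constant is not a Schwartz function, so the constant term has to be removed. -/
theorem exists_jetEval (p : DiffPoly) : ∃ Y : 𝓢(ℝ, ℝ) × 𝓢(ℝ, ℝ) → 𝓢(ℝ, ℝ),
    IsPolyMap Y ∧ ∀ w x, Y w x = aeval (jet w x) p - constantCoeff p := by
  induction p using MvPolynomial.induction_on with
  | C a => exact ⟨fun _ => 0, .zero, fun w x => by simp⟩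
  | add p q hp hq =>
    obtain ⟨Y, hY, h⟩ := hp
    obtain ⟨Z, hZ, h'⟩ := hq
    refine ⟨_, hY.add hZ, fun w x => ?_⟩
    simp only [add_apply, h, h', map_add]
    ring
  | mul_X p i hp =>
    obtain ⟨Y, hY, h⟩ := hp
    obtain ⟨Z, hZ, h'⟩ : ∃ Z : 𝓢(ℝ, ℝ) × 𝓢(ℝ, ℝ) → 𝓢(ℝ, ℝ),
        IsPolyMap Z ∧ ∀ w x, Z w x = jet w x i := by
      by_cases hi : i.1 = 0
      · exact ⟨_, (isPolyMap_dx_pow i.2).precomp (.fst ℝ _ _), fun w x => by simp [jet, hi]⟩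
      · exact ⟨_, (isPolyMap_dx_pow i.2).precomp (.snd ℝ _ _), fun w x => by simp [jet, hi]⟩
    -- With `c` the constant term of `p`, `p X_i = (p - c) X_i + c X_i`, and `p X_i` itself has no
    -- constant term.
    refine ⟨_, (hY.mulOp hZ).add (hZ.smul (constantCoeff p)), fun w x => ?_⟩
    simp only [add_apply, smul_apply, mulOp_apply, h, h', map_mul, aeval_X, constantCoeff_X,
      smul_eq_mul]
    ring

/-- Evaluation of a differential polynomial, up to its constant term. -/
def jetEval (p : DiffPoly) : 𝓢(ℝ, ℝ) × 𝓢(ℝ, ℝ) → 𝓢(ℝ, ℝ) := (exists_jetEval p).choose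

theorem isPolyMap_jetEval (p : DiffPoly) : IsPolyMap (jetEval p) :=
  (exists_jetEval p).choose_spec.1

theorem jetEval_apply (p : DiffPoly) (w : 𝓢(ℝ, ℝ) × 𝓢(ℝ, ℝ)) (x : ℝ) :
    jetEval p w x = aeval (jet w x) p - constantCoeff p :=
  (exists_jetEval p).choose_spec.2 w x

theorem dx_jetEval (p : DiffPoly) (w : 𝓢(ℝ, ℝ) × 𝓢(ℝ, ℝ)) :
    dx (jetEval p w) = jetEval (totalD p) w := by
  ext x
  have h : (jetEval p w : ℝ → ℝ) = fun y => aeval (jet w y) p - constantCoeff p :=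
    funext (jetEval_apply p w)
  have := hasDerivAt_aeval totalD (fun y => jet w y) x
    (fun i => by rw [totalD_X, aeval_X]; exact hasDerivAt_jet w x i) p
  rw [dx_apply, h, (this.sub_const _).deriv, jetEval_apply, constantCoeff_totalD, sub_zero]

/-- Evaluation at a point. -/
def evalAt (x : ℝ) : 𝓢(ℝ, ℝ) →L[ℝ] ℝ :=
  (BoundedContinuousFunction.evalCLM ℝ x).comp
    (SchwartzMap.toBoundedContinuousFunctionCLM ℝ ℝ ℝ)

theorem evalAt_apply (x : ℝ) (f : 𝓢(ℝ, ℝ)) : evalAt x f = f x := rfl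

/-- Differential polynomials in the first function only. -/
abbrev scalarDiffPoly : Subalgebra ℝ DiffPoly := supported ℝ {i : Fin 2 × ℕ | i.1 = 0}

theorem totalD_mem_supported {s t : Set (Fin 2 × ℕ)} (hst : s ⊆ t)
    (h : ∀ i ∈ s, (i.1, i.2 + 1) ∈ t) {p : DiffPoly} (hp : p ∈ supported ℝ s) :
    totalD p ∈ supported ℝ t := by
  rw [supported_eq_adjoin_X] at hp
  induction hp using Algebra.adjoin_induction with
  | mem q hq =>
    obtain ⟨i, hi, rfl⟩ := hq
    rw [totalD_X]
    exact X_mem_supported.2 (h i hi)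
  | algebraMap r => simp
  | add p q _ _ hp hq => rw [map_add]; exact add_mem hp hq
  | mul p q hp' hq' hp hq =>
    rw [Derivation.leibniz]
    rw [← supported_eq_adjoin_X] at hp' hq'
    exact add_mem (mul_mem (supported_mono hst hp') hq) (mul_mem (supported_mono hst hq') hp)

theorem totalD_mem_scalarDiffPoly {p : DiffPoly} (hp : p ∈ scalarDiffPoly) :
    totalD p ∈ scalarDiffPoly :=
  totalD_mem_supported subset_rfl (fun _ hi => hi) hp

theorem aeval_eq_of_mem_supported {s : Set (Fin 2 × ℕ)} {p : DiffPoly}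
    (hp : p ∈ supported ℝ s) {f g : Fin 2 × ℕ → ℝ} (h : ∀ i ∈ s, f i = g i) :
    aeval f p = aeval g p := by
  rw [supported_eq_adjoin_X] at hp
  induction hp using Algebra.adjoin_induction with
  | mem q hq =>
    obtain ⟨i, hi, rfl⟩ := hq
    simpa using h i hi
  | algebraMap r => simp
  | add p q _ _ hp hq => rw [map_add, map_add, hp, hq]
  | mul p q _ _ hp hq => rw [map_mul, map_mul, hp, hq]

theorem jetEval_eq_of_mem_scalarDiffPoly {p : DiffPoly} (hp : p ∈ scalarDiffPoly)
    (u v v' : 𝓢(ℝ, ℝ)) : jetEval p (u, v) = jetEval p (u, v') := by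
  ext x
  rw [jetEval_apply, jetEval_apply, aeval_eq_of_mem_supported hp]
  intro i hi
  have hi' : i.1 = 0 := hi
  simp [jet, hi']

theorem HasDerivAt.hasCurveDeriv {c : ℝ → ℝ} {w : ℝ} (h : HasDerivAt c w 0) :
    HasCurveDeriv c w := by
  have := hasDerivAt_iff_tendsto_slope_zero.1 h
  simpa [HasCurveDeriv] using this

theorem isPolyMap_jetEval_left (p : DiffPoly) :
    IsPolyMap fun u : 𝓢(ℝ, ℝ) => jetEval p (u, 0) :=
  (isPolyMap_jetEval p).precomp (.inl ℝ _ _)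

/-- The derivative exists in the Schwartz space because the map is polynomial, so it can be
identified pointwise, where it is a derivative of a real function of `t`. -/
theorem gateaux_jetEval {p : DiffPoly} (hp : p ∈ scalarDiffPoly) (u v : 𝓢(ℝ, ℝ)) :
    gateaux (fun w => jetEval p (w, 0)) u v = jetEval (varD p) (u, v) := by
  ext x
  have h1 := ((isPolyMap_jetEval_left p).hasCurveDeriv u v).clm (evalAt x)
  refine h1.unique (PerturbedKdV.HasDerivAt.hasCurveDeriv ?_)
  have h2 := (hasDerivAt_aeval varD (fun t : ℝ => jet (u + t • v, v) x) 0 (fun i => ?_) p).sub_const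
    (constantCoeff p)
  · rw [jetEval_apply, constantCoeff_varD, sub_zero]
    simp only [zero_smul, add_zero] at h2
    refine h2.congr_of_eventuallyEq (Eventually.of_forall fun t => ?_)
    simp only [evalAt_apply]
    -- The second slot is irrelevant for `p`; filling it with `v` lets `varD` describe the velocity
    -- of the jets.
    rw [jetEval_eq_of_mem_scalarDiffPoly hp _ 0 v, jetEval_apply]
  · rw [varD_X]
    by_cases hi : i.1 = 0
    · simp only [jet, hi, if_true, map_add, map_smul, add_apply, smul_apply, smul_eq_mul, aeval_X]
      simpa using ((hasDerivAt_id (0 : ℝ)).mul_const (((dx ^ i.2) v) x)).const_add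
        (((dx ^ i.2) u) x)
    · simpa [jet, hi] using hasDerivAt_const (0 : ℝ) (((dx ^ i.2) v) x)

end Jets

/-! ### Gradients of the KdV Hamiltonians -/

section Gradients

open MvPolynomial

/-- The gradient `f_n(u)` of the `n`-th KdV Hamiltonian. -/
def gradKdV (n : ℕ) (u : 𝓢(ℝ, ℝ)) : 𝓢(ℝ, ℝ) :=
  jetEval (resolvent totalD (X (0, 0)) n) (u, 0)

theorem resolvent_mem_scalarDiffPoly (n : ℕ) :
    (resolvent totalD (X (0, 0)) n : DiffPoly) ∈ scalarDiffPoly :=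
  resolvent_mem (A := DiffPoly) (D := totalD) scalarDiffPoly (X_mem_supported.2 rfl)
    (fun _ h => totalD_mem_scalarDiffPoly h) n

theorem isPolyMap_gradKdV (n : ℕ) : IsPolyMap (gradKdV n) :=
  isPolyMap_jetEval_left _

theorem gradKdV_zero (u : 𝓢(ℝ, ℝ)) : gradKdV 0 u = u := by
  ext x
  simp [gradKdV, jetEval_apply, resolvent, jet]

theorem constantCoeff_resolvent (n : ℕ) :
    constantCoeff (resolvent totalD (X (0, 0)) n : DiffPoly) = 0 := by
  induction n using Nat.strong_induction_on with
  | _ n ih =>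
    match n with
    | 0 => simp [resolvent]
    | 1 => simp [resolvent, constantCoeff_totalD]
    | n + 2 =>
      rw [resolvent]
      simp only [map_add, map_sub, map_mul, map_sum, constantCoeff_totalD, constantCoeff_X]
      have h : ∀ i : Fin (n + 2),
          constantCoeff (resolvent totalD (X (0, 0)) i : DiffPoly) = 0 := fun i => ih i i.2
      simp [h]

theorem gradKdV_apply (n : ℕ) (u : 𝓢(ℝ, ℝ)) (x : ℝ) :
    gradKdV n u x = aeval (jet (u, 0) x) (resolvent totalD (X (0, 0)) n) := by
  rw [gradKdV, jetEval_apply, constantCoeff_resolvent, sub_zero]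

theorem dx_gradKdV_succ (n : ℕ) (u : 𝓢(ℝ, ℝ)) :
    dx (gradKdV (n + 1) u) = dx (dx (dx (gradKdV n u))) + (2 : ℝ) • mulOp (dx u) (gradKdV n u)
      + (4 : ℝ) • mulOp u (dx (gradKdV n u)) := by
  ext x
  simp only [gradKdV, dx_jetEval, add_apply, smul_apply, mulOp_apply, smul_eq_mul]
  rw [deriv_resolvent_succ]
  simp only [jetEval_apply, constantCoeff_totalD, sub_zero, constantCoeff_resolvent, map_add,
    map_mul, totalD_X, aeval_X, map_ofNat]
  simp only [jet, if_true]
  simp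
  ring

theorem m0_apply (u s : 𝓢(ℝ, ℝ)) : m0 u s = dx (dx (dx s)) + m1 u s := rfl

theorem m1_apply (v s : 𝓢(ℝ, ℝ)) :
    m1 v s = (2 : ℝ) • mulOp (dx v) s + (4 : ℝ) • mulOp v (dx s) := by
  have : m1 v s = (2 : ℝ) • (dx (mulOp v s) + mulOp v (dx s)) := rfl
  rw [this, dx_mulOp]
  module

theorem dx_gradKdV_succ_eq_m0 (n : ℕ) (u : 𝓢(ℝ, ℝ)) :
    dx (gradKdV (n + 1) u) = m0 u (gradKdV n u) := by
  rw [dx_gradKdV_succ, m0_apply, m1_apply, add_assoc]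

/-- Decay at `-∞` fixes the integration constant. -/
theorem invDx_dx (s : 𝓢(ℝ, ℝ)) (x : ℝ) : invDx (dx s) x = s x := by
  have h := integral_Iic_of_hasDerivAt_of_tendsto' (f := s) (f' := dx s) (a := x) (m := 0)
    (fun y _ => hasDerivAt_dx s y) (dx s).integrable.integrableOn
    ((SchwartzMap.toZeroAtInfty s).zero_at_infty'.mono_left _root_.atBot_le_cocompact)
  rw [invDx, h, sub_zero]

theorem phi0_apply (u s : 𝓢(ℝ, ℝ)) : phi0 u s = dx (dx s) + phi1 u s := rfl

theorem phi1_apply (v s : 𝓢(ℝ, ℝ)) :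
    phi1 v s = (2 : ℝ) • mulInvDx (dx v) s + (4 : ℝ) • mulOp v s := rfl

theorem phi1_dx (v s : 𝓢(ℝ, ℝ)) : phi1 v (dx s) = m1 v s := by
  ext x
  simp [phi1_apply, m1_apply, mulInvDx_apply, mulOp_apply, invDx_dx]

theorem phi0_dx (u s : 𝓢(ℝ, ℝ)) : phi0 u (dx s) = m0 u s := by
  rw [phi0_apply, phi1_dx, m0_apply]

theorem kdv_eq_dx_gradKdV (n : ℕ) (u : 𝓢(ℝ, ℝ)) : kdv n u = dx (gradKdV n u) := by
  induction n with
  | zero => simp [kdv, gradKdV_zero]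
  | succ n ih =>
    rw [dx_gradKdV_succ_eq_m0, ← phi0_dx, ← ih, kdv, pow_succ']
    rfl

theorem kdv_succ (n : ℕ) (u : 𝓢(ℝ, ℝ)) : kdv (n + 1) u = phi0 u (kdv n u) := by
  rw [kdv, pow_succ']
  rfl

/-- By the recursion, `-2 u_x f_n` is the derivative of the Schwartz function `f_{n+1} - ∂² f_n - 4
u f_n`, so the nonlocal term of `Ψ` evaluates exactly to that function. -/
theorem fKdV_eq_gradKdV (n : ℕ) (u : 𝓢(ℝ, ℝ)) : fKdV n u = gradKdV n u := by
  induction n with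
  | zero => simp [fKdV, gradKdV_zero]
  | succ n ih =>
    rw [fKdV, Function.iterate_succ_apply', ← fKdV, ih]
    funext x
    have h1 : (deriv (gradKdV n u) : ℝ → ℝ) = dx (gradKdV n u) := rfl
    have h2 : deriv (dx (gradKdV n u)) x = dx (dx (gradKdV n u)) x := rfl
    have h3 : (fun y => deriv u y * gradKdV n u y) = mulOp (dx u) (gradKdV n u) := by
      funext y
      rw [mulOp_apply, dx_apply]
    rw [psi, h1, h2, h3]
    have h4 : (-2 : ℝ) • mulOp (dx u) (gradKdV n u)
        = dx (gradKdV (n + 1) u - dx (dx (gradKdV n u)) - (4 : ℝ) • mulOp u (gradKdV n u)) := by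
      rw [map_sub, map_sub, map_smul, dx_mulOp, dx_gradKdV_succ]
      module
    have h5 := invDx_dx
      (gradKdV (n + 1) u - dx (dx (gradKdV n u)) - (4 : ℝ) • mulOp u (gradKdV n u)) x
    rw [← h4, invDx_smul] at h5
    simp only [sub_apply, smul_apply, mulOp_apply, smul_eq_mul] at h5
    linarith

end Gradients

/-! ### The pairing -/

section Pairing

/-- Integration over the line. -/
abbrev integ : 𝓢(ℝ, ℝ) →L[ℝ] ℝ := SchwartzMap.integralCLM ℝ volume

theorem pair_eq_integ (a s : 𝓢(ℝ, ℝ)) : pair a s = integ (mulOp a s) := by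
  rw [SchwartzMap.integralCLM_apply]
  simp only [mulOp_apply, pair]

theorem integ_dx (s : 𝓢(ℝ, ℝ)) : integ (dx s) = 0 := by
  rw [SchwartzMap.integralCLM_apply]
  exact integral_eq_zero_of_hasDerivAt_of_integrable (fun x => hasDerivAt_dx s x)
    (dx s).integrable s.integrable

/-- The pairing as a bilinear map. -/
def pairBilin : 𝓢(ℝ, ℝ) →ₗ[ℝ] 𝓢(ℝ, ℝ) →ₗ[ℝ] ℝ :=
  mulBilin.compr₂ integ.toLinearMap

theorem pairBilin_apply (a s : 𝓢(ℝ, ℝ)) : pairBilin a s = pair a s := (pair_eq_integ a s).symm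

theorem continuous_pairBilin :
    Continuous fun p : 𝓢(ℝ, ℝ) × 𝓢(ℝ, ℝ) => pairBilin p.1 p.2 :=
  integ.continuous.comp continuous_mulBilin

theorem pair_add_left (a b s : 𝓢(ℝ, ℝ)) : pair (a + b) s = pair a s + pair b s := by
  simp only [← pairBilin_apply, map_add, LinearMap.add_apply]

theorem pair_add_right (a s t : 𝓢(ℝ, ℝ)) : pair a (s + t) = pair a s + pair a t := by
  simp only [← pairBilin_apply, map_add]

theorem pair_smul_left (c : ℝ) (a s : 𝓢(ℝ, ℝ)) : pair (c • a) s = c * pair a s := by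
  simp only [← pairBilin_apply, map_smul, LinearMap.smul_apply, smul_eq_mul]

theorem pair_smul_right (c : ℝ) (a s : 𝓢(ℝ, ℝ)) : pair a (c • s) = c * pair a s := by
  simp only [← pairBilin_apply, map_smul, smul_eq_mul]

theorem pair_zero_right (a : 𝓢(ℝ, ℝ)) : pair a 0 = 0 := by
  simp only [← pairBilin_apply, map_zero]

theorem pair_comm (a s : 𝓢(ℝ, ℝ)) : pair a s = pair s a := by
  simp only [pair, mul_comm]

theorem HasCurveDeriv.pair {c d : ℝ → 𝓢(ℝ, ℝ)} {v w : 𝓢(ℝ, ℝ)} (h : HasCurveDeriv c v)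
    (h' : HasCurveDeriv d w) :
    HasCurveDeriv (fun t => pair (c t) (d t)) (pair v (d 0) + pair (c 0) w) := by
  simpa only [pairBilin_apply] using h.bilin continuous_pairBilin h'

theorem pair_dx_skew (a b : 𝓢(ℝ, ℝ)) : pair a (dx b) = -pair b (dx a) := by
  rw [eq_neg_iff_add_eq_zero, pair_eq_integ, pair_eq_integ, ← map_add,
    show mulOp a (dx b) + mulOp b (dx a) = dx (mulOp a b) from ?_, integ_dx]
  ext x
  simp only [dx_mulOp, add_apply, mulOp_apply]
  ring

theorem pair_dx3_skew (a b : 𝓢(ℝ, ℝ)) : pair a (dx (dx (dx b))) = -pair b (dx (dx (dx a))) := by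
  rw [pair_dx_skew a, pair_comm, pair_dx_skew (dx a), neg_neg, pair_comm, pair_dx_skew]

theorem pair_m1_skew (v a b : 𝓢(ℝ, ℝ)) : pair a (m1 v b) = -pair b (m1 v a) := by
  rw [eq_neg_iff_add_eq_zero, pair_eq_integ, pair_eq_integ, ← map_add,
    show mulOp a (m1 v b) + mulOp b (m1 v a) = dx ((4 : ℝ) • mulOp v (mulOp a b)) from ?_,
    integ_dx]
  ext x
  simp only [map_smul, dx_mulOp, map_add, m1_apply, add_apply, smul_apply, mulOp_apply,
    smul_eq_mul]
  ring

theorem pair_m0_skew (u a b : 𝓢(ℝ, ℝ)) : pair a (m0 u b) = -pair b (m0 u a) := by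
  rw [m0_apply, m0_apply, pair_add_right, pair_add_right, pair_dx3_skew, pair_m1_skew]
  ring

/-- The Lenard–Magri argument: skew-symmetry of `∂` and `M` moves one step of the recursion across
the pairing. Sliding everything to one side shows that the pairing of `f_{l+m}` with `∂ f_0` equals
its own negative. -/
theorem pair_gradKdV_dx (l m : ℕ) (u : 𝓢(ℝ, ℝ)) :
    pair (gradKdV l u) (dx (gradKdV m u)) = 0 := by
  have step : ∀ l m, pair (gradKdV (l + 1) u) (dx (gradKdV m u))
      = pair (gradKdV l u) (dx (gradKdV (m + 1) u)) := fun l m => by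
    rw [pair_dx_skew, dx_gradKdV_succ_eq_m0, dx_gradKdV_succ_eq_m0, pair_m0_skew, neg_neg]
  have h : ∀ l m, pair (gradKdV l u) (dx (gradKdV m u))
      = pair (gradKdV 0 u) (dx (gradKdV (l + m) u)) := fun l => by
    induction l with
    | zero => intro m; rw [zero_add]
    | succ l ih =>
      intro m
      rw [step, ih, show l + (m + 1) = l + 1 + m by omega]
  have h1 := h (l + m) 0
  have h2 := pair_dx_skew (gradKdV (l + m) u) (gradKdV 0 u)
  rw [add_zero] at h1
  rw [h l m]
  linarith

end Pairing

/-! ### The Hamiltonian functionals -/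

section Functionals

open MvPolynomial

/-- A local density for the `n`-th Hamiltonian: the potential divided by `8(n+1)`. The total
derivative in its variation integrates to zero. -/
theorem exists_density (n : ℕ) : ∃ Γ : 𝓢(ℝ, ℝ) → 𝓢(ℝ, ℝ), IsPolyMap Γ ∧ Γ 0 = 0 ∧
    ∀ u v, integ (gateaux Γ u v) = pair (gradKdV n u) v := by
  obtain ⟨g, hg, hδ⟩ := exists_resolvent_potential totalD (X (0, 0) : DiffPoly) n
  obtain ⟨h, hh⟩ := hδ varD totalD_varD
  have hg' : g ∈ scalarDiffPoly :=
    hg _ (X_mem_supported.2 rfl) fun _ h => totalD_mem_scalarDiffPoly h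
  have hc : (8 * (n + 1) : ℝ) ≠ 0 := by positivity
  set c : ℝ := 8 * (n + 1) with hcdef
  refine ⟨fun u => c⁻¹ • jetEval g (u, 0), (isPolyMap_jetEval_left g).smul _, ?_, fun u v => ?_⟩
  · ext x
    have : jet ((0 : 𝓢(ℝ, ℝ)), 0) x = 0 := by
      funext i
      simp [jet]
    simp [jetEval_apply, this, aeval_zero]
  · have h1 : gateaux (fun u => c⁻¹ • jetEval g (u, 0)) u v
        = c⁻¹ • jetEval (varD g) (u, v) := by
      rw [← gateaux_jetEval hg']
      exact gateaux_eq_of_hasCurveDeriv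
        (((isPolyMap_jetEval_left g).hasCurveDeriv u v).const_smul _)
    have h2 : c • mulOp (gradKdV n u) v = jetEval (varD g) (u, v) + dx (jetEval h (u, v)) := by
      ext x
      have := congrArg (aeval (jet (u, v) x)) hh
      rw [dx_jetEval]
      simp only [add_apply, smul_apply, mulOp_apply, jetEval_apply, constantCoeff_varD,
        constantCoeff_totalD, sub_zero, gradKdV_apply, smul_eq_mul]
      rw [← map_add, ← this, map_smul, map_mul, varD_X, if_pos rfl, aeval_X,
        aeval_eq_of_mem_supported (resolvent_mem_scalarDiffPoly n)
          (g := jet (u, v) x) (fun i hi => by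
            have hi' : i.1 = 0 := hi
            simp [jet, hi'])]
      simp [jet]
    have h3 := congrArg integ h2
    rw [map_add, integ_dx, add_zero, map_smul, ← pair_eq_integ] at h3
    rw [h1, map_smul, ← h3, smul_smul, inv_mul_cancel₀ hc, one_smul]

/-- Both sides are the integrated second derivative of a density, which is symmetric. -/
theorem pair_gateaux_gradKdV_symm (n : ℕ) (u v w : 𝓢(ℝ, ℝ)) :
    pair (gateaux (gradKdV n) u v) w = pair (gateaux (gradKdV n) u w) v := by
  obtain ⟨Γ, hΓ, -, h⟩ := exists_density n
  have key : ∀ v w, pair (gateaux (gradKdV n) u w) v = integ (hess Γ u v w) := fun v w => by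
    have h1 := ((isPolyMap_gradKdV n).hasCurveDeriv u w).pair (hasCurveDeriv_const v)
    have h2 := (hΓ.hasCurveDeriv_gateaux (hasCurveDeriv_line u w) (hasCurveDeriv_const v)).clm
      integ
    simp only [h] at h2
    have h3 := h1.unique h2
    rw [pair_zero_right, add_zero, zero_smul, add_zero] at h3
    rw [h3]
    rw [hΓ.gateaux_zero, add_zero]
  rw [key, key, hΓ.hess_comm]

theorem HasCurveDeriv.hasDerivAt {c : ℝ → ℝ} {w l : ℝ}
    (h : HasCurveDeriv (fun t => c (l + t)) w) : HasDerivAt c w l := by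
  rw [hasDerivAt_iff_tendsto_slope_zero]
  simpa [HasCurveDeriv] using h

/-- Fubini. The integrand is dominated by `C |u(x)|`, with `C` bounding the sup norms of `f_n(λu)`
over the compact interval of `λ`. -/
theorem hamKdV_eq_intervalIntegral (n : ℕ) (u : 𝓢(ℝ, ℝ)) :
    hamKdV n u = ∫ l in (0 : ℝ)..1, pair (gradKdV n (l • u)) u := by
  have e : ∀ l : ℝ, fKdV n (fun y => l * u y) = gradKdV n (l • u) := fun l =>
    fKdV_eq_gradKdV n (l • u)
  let c : ℝ → BoundedContinuousFunction ℝ ℝ := fun l =>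
    SchwartzMap.toBoundedContinuousFunctionCLM ℝ ℝ ℝ (gradKdV n (l • u))
  have hc : Continuous c := (ContinuousLinearMap.continuous _).comp
    ((isPolyMap_gradKdV n).continuous.comp (by fun_prop))
  have hcont : Continuous fun p : ℝ × ℝ => u p.2 * gradKdV n (p.1 • u) p.2 :=
    (u.continuous.comp continuous_snd).mul
      ((hc.comp continuous_fst).eval continuous_snd)
  obtain ⟨C, hC⟩ := (isCompact_Icc (a := (0 : ℝ)) (b := 1)).exists_bound_of_continuousOn
    hc.continuousOn
  have : IsFiniteMeasure (volume.restrict (Set.uIoc (0 : ℝ) 1)) := by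
    rw [Set.uIoc_of_le zero_le_one]
    infer_instance
  have hint : Integrable (Function.uncurry fun (l x : ℝ) => u x * gradKdV n (l • u) x)
      ((volume.restrict (Set.uIoc 0 1)).prod volume) := by
    have hb : Integrable (fun p : ℝ × ℝ => ‖u p.2‖ * C)
        ((volume.restrict (Set.uIoc (0 : ℝ) 1)).prod volume) :=
      (u.integrable.norm.mul_const C).comp_snd _
    refine hb.mono' hcont.aestronglyMeasurable ?_
    have : (volume.restrict (Set.uIoc (0 : ℝ) 1)).prod (volume : Measure ℝ)
        = (volume.prod volume).restrict (Set.uIoc (0 : ℝ) 1 ×ˢ Set.univ) := by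
      rw [← Measure.prod_restrict, Measure.restrict_univ]
    rw [this]
    refine ae_restrict_of_forall_mem (measurableSet_uIoc.prod .univ) fun p hp => ?_
    have hp1 : p.1 ∈ Set.Icc (0 : ℝ) 1 := by
      have := hp.1
      rw [Set.uIoc_of_le zero_le_one] at this
      exact Set.Ioc_subset_Icc_self this
    rw [Function.uncurry, norm_mul]
    exact mul_le_mul_of_nonneg_left (((c p.1).norm_coe_le_norm p.2).trans (hC _ hp1))
      (norm_nonneg _)
  simp only [hamKdV, e]
  rw [← intervalIntegral_integral_swap hint]
  simp only [pair, mul_comm]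

/-- The homotopy formula: `λ ↦ ∫ Γ(λu)` has the integrand as its derivative and vanishes at `0`. -/
theorem hamKdV_eq_integ {n : ℕ} {Γ : 𝓢(ℝ, ℝ) → 𝓢(ℝ, ℝ)} (hΓ : IsPolyMap Γ) (h0 : Γ 0 = 0)
    (h : ∀ u v, integ (gateaux Γ u v) = pair (gradKdV n u) v) (u : 𝓢(ℝ, ℝ)) :
    hamKdV n u = integ (Γ u) := by
  rw [hamKdV_eq_intervalIntegral]
  have hd : ∀ l : ℝ, HasDerivAt (fun l : ℝ => integ (Γ (l • u))) (pair (gradKdV n (l • u)) u) l :=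
    fun l => by
      refine HasCurveDeriv.hasDerivAt ?_
      have := (hΓ.hasCurveDeriv (l • u) u).clm integ
      rw [h] at this
      simpa only [add_smul] using this
  have hcont : Continuous fun l : ℝ => pair (gradKdV n (l • u)) u := by
    have : Continuous fun l : ℝ => pairBilin (gradKdV n (l • u)) u :=
      continuous_pairBilin.comp (((isPolyMap_gradKdV n).continuous.comp
        (by fun_prop : Continuous fun l : ℝ => l • u)).prodMk continuous_const)
    simpa only [pairBilin_apply] using this
  rw [intervalIntegral.integral_eq_sub_of_hasDerivAt (fun l _ => hd l)
    (hcont.intervalIntegrable _ _)]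
  simp [h0]

theorem isVariationalDerivative_hamKdV (n : ℕ) :
    IsVariationalDerivative pair (hamKdV n) (gradKdV n) := by
  obtain ⟨Γ, hΓ, h0, h⟩ := exists_density n
  have e : hamKdV n = fun u => integ (Γ u) := funext (hamKdV_eq_integ hΓ h0 h)
  refine ⟨e ▸ hΓ.isSmooth.clm integ, (isPolyMap_gradKdV n).isSmooth, fun u v => ?_⟩
  rw [e, ← h]
  exact (hΓ.hasCurveDeriv u v).clm integ

theorem perFunctional_hamKdV (n : ℕ) (η : 𝓢(ℝ, ℝ) × 𝓢(ℝ, ℝ)) :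
    perFunctional (hamKdV n) η = pair (gradKdV n η.1) η.2 :=
  ((isVariationalDerivative_hamKdV n).2.2 η.1 η.2).curveDeriv

/-- The gradient of the functional `per₁ H̃_n + a H̃_n(η₀)`. -/
def gradPer (n : ℕ) (a : ℝ) (η : 𝓢(ℝ, ℝ) × 𝓢(ℝ, ℝ)) : 𝓢(ℝ, ℝ) × 𝓢(ℝ, ℝ) :=
  (gateaux (gradKdV n) η.1 η.2 + a • gradKdV n η.1, gradKdV n η.1)

theorem isVariationalDerivative_per (n : ℕ) (a : ℝ) :
    IsVariationalDerivative pair2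
      (fun η => perFunctional (hamKdV n) η + a * hamKdV n η.1) (gradPer n a) := by
  obtain ⟨Γ, hΓ, h0, h⟩ := exists_density n
  have hF := isPolyMap_gradKdV n
  have hF1 : IsPolyMap fun η : 𝓢(ℝ, ℝ) × 𝓢(ℝ, ℝ) => gradKdV n η.1 :=
    hF.precomp (.fst ℝ 𝓢(ℝ, ℝ) 𝓢(ℝ, ℝ))
  refine ⟨?_, ?_, fun η v => ?_⟩
  · have e : (fun η : 𝓢(ℝ, ℝ) × 𝓢(ℝ, ℝ) => perFunctional (hamKdV n) η + a * hamKdV n η.1)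
        = fun η => integ (mulOp (gradKdV n η.1) η.2 + a • Γ η.1) := by
      funext η
      rw [perFunctional_hamKdV, hamKdV_eq_integ hΓ h0 h, pair_eq_integ, map_add, map_smul,
        smul_eq_mul]
    rw [e]
    exact ((hF1.mulOp (.clm (.snd ℝ _ _))).add
      ((hΓ.precomp (.fst ℝ _ _)).smul a)).isSmooth.clm integ
  · exact (hF.tangent.add (hF1.smul a)).isSmooth.prodMk hF1.isSmooth
  · simp only [perFunctional_hamKdV]
    have h1 := (hF.hasCurveDeriv η.1 v.1).pair (hasCurveDeriv_line η.2 v.2)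
    have h2 := ((isVariationalDerivative_hamKdV n).2.2 η.1 v.1).const_smul a
    have h3 := h1.add h2
    simp only [zero_smul, add_zero, smul_eq_mul] at h3
    refine (congrArg (HasCurveDeriv _) ?_).mp h3
    -- Self-adjointness of `f_n'(η₀)` moves the variation of `η₀` out of the derivative, leaving
    -- `f_n'(η₀)[η₁]` as gradient component.
    rw [pair2, gradPer, pair_add_left, pair_smul_left, pair_gateaux_gradKdV_symm]
    ring

end Functionals

/-! ### Commuting flows -/

section Flows

theorem phi1_eq_dx_add (k s : 𝓢(ℝ, ℝ)) :
    phi1 k s = dx ((2 : ℝ) • mulInvDx k s) + (2 : ℝ) • mulOp k s := by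
  rw [map_smul, dx_mulInvDx, phi1_apply]
  module

/-- Resolves nested integrals: in the heredity identity the only remaining one of a product is
`∂⁻¹(ks)`, which is symmetric in `k` and `s`. -/
theorem invDx_phi1 (k s : 𝓢(ℝ, ℝ)) (x : ℝ) :
    invDx (phi1 k s) x = 2 * (k x * invDx s x) + 2 * invDx (mulOp k s) x := by
  rw [phi1_eq_dx_add, invDx_add, invDx_dx, invDx_smul, smul_apply, mulInvDx_apply,
    smul_eq_mul]

theorem phi1_add_left (k k' s : 𝓢(ℝ, ℝ)) : phi1 (k + k') s = phi1 k s + phi1 k' s := by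
  ext x
  simp only [phi1_apply, add_apply, smul_apply, mulInvDx_apply, mulOp_apply, map_add, smul_eq_mul]
  ring

theorem phi1_smul_left (c : ℝ) (k s : 𝓢(ℝ, ℝ)) : phi1 (c • k) s = c • phi1 k s := by
  ext x
  simp only [phi1_apply, add_apply, smul_apply, mulInvDx_apply, mulOp_apply, map_smul,
    smul_eq_mul]
  ring

/-- The bilinear map `(k, s) ↦ Φ₁(k) s = Φ'(u)[k] s`. -/
def phi1Bilin : 𝓢(ℝ, ℝ) →ₗ[ℝ] 𝓢(ℝ, ℝ) →ₗ[ℝ] 𝓢(ℝ, ℝ) :=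
  LinearMap.mk₂ ℝ (fun k s => phi1 k s) phi1_add_left phi1_smul_left
    (fun _ _ _ => map_add _ _ _) (fun _ _ _ => map_smul _ _ _)

theorem phi1Bilin_apply (k s : 𝓢(ℝ, ℝ)) : phi1Bilin k s = phi1 k s := rfl

theorem continuous_phi1Bilin :
    Continuous fun p : 𝓢(ℝ, ℝ) × 𝓢(ℝ, ℝ) => phi1Bilin p.1 p.2 := by
  have h1 := continuous_mulInvDxBilin.comp
    (((SchwartzMap.derivCLM ℝ ℝ).continuous.comp
      (continuous_fst (X := 𝓢(ℝ, ℝ)) (Y := 𝓢(ℝ, ℝ)))).prodMk continuous_snd)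
  exact (h1.const_smul (2 : ℝ)).add (continuous_mulBilin.const_smul (4 : ℝ))

theorem HasCurveDeriv.phi1 {c d : ℝ → 𝓢(ℝ, ℝ)} {v w : 𝓢(ℝ, ℝ)} (h : HasCurveDeriv c v)
    (h' : HasCurveDeriv d w) :
    HasCurveDeriv (fun t => phi1 (c t) (d t)) (phi1 v (d 0) + phi1 (c 0) w) := by
  simpa only [phi1Bilin_apply] using h.bilin continuous_phi1Bilin h'

theorem HasCurveDeriv.dx {c : ℝ → 𝓢(ℝ, ℝ)} {v : 𝓢(ℝ, ℝ)} (h : HasCurveDeriv c v) :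
    HasCurveDeriv (fun t => dx (c t)) (dx v) :=
  h.clm (SchwartzMap.derivCLM ℝ ℝ)

theorem HasCurveDeriv.phi0 {c d : ℝ → 𝓢(ℝ, ℝ)} {v w : 𝓢(ℝ, ℝ)} (h : HasCurveDeriv c v)
    (h' : HasCurveDeriv d w) :
    HasCurveDeriv (fun t => phi0 (c t) (d t)) (PerturbedKdV.phi1 v (d 0) + phi0 (c 0) w) := by
  have := h'.dx.dx.add (h.phi1 h')
  refine (congrArg (HasCurveDeriv _) ?_).mp this
  rw [phi0_apply]
  abel

theorem IsPolyMap.phi1 {E : Type*} [AddCommGroup E] [Module ℝ E] [TopologicalSpace E]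
    {X Y : E → 𝓢(ℝ, ℝ)} (hX : IsPolyMap X) (hY : IsPolyMap Y) :
    IsPolyMap fun u => phi1 (X u) (Y u) :=
  .bilin continuous_phi1Bilin hX hY

theorem IsPolyMap.phi0 {E : Type*} [AddCommGroup E] [Module ℝ E] [TopologicalSpace E]
    {X Y : E → 𝓢(ℝ, ℝ)} (hX : IsPolyMap X) (hY : IsPolyMap Y) :
    IsPolyMap fun u => phi0 (X u) (Y u) :=
  hY.dx.dx.add (hX.phi1 hY)

/-- The part of the heredity identity that is independent of `u`. -/
theorem phi1_hereditary_dx (k s : 𝓢(ℝ, ℝ)) :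
    phi1 (dx (dx k)) s - dx (dx (phi1 k s)) = phi1 (dx (dx s)) k - dx (dx (phi1 s k)) := by
  -- The nonlocal terms `2 k_xxx ∂⁻¹ s` cancel; the local remainder is symmetric in `k` and `s`.
  have h : ∀ k s : 𝓢(ℝ, ℝ), phi1 (dx (dx k)) s - dx (dx (phi1 k s))
      = -((4 : ℝ) • mulOp (dx (dx k)) s) - (10 : ℝ) • mulOp (dx k) (dx s)
        - (4 : ℝ) • mulOp k (dx (dx s)) := fun k s => by
    ext x
    simp only [phi1_apply, map_add, map_smul, dx_mulOp, dx_mulInvDx, sub_apply, add_apply,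
      smul_apply, neg_apply, mulOp_apply, mulInvDx_apply, smul_eq_mul]
    ring
  rw [h, h]
  ext x
  simp only [sub_apply, smul_apply, neg_apply, mulOp_apply, smul_eq_mul]
  ring

/-- The part of the heredity identity that is linear in `u`. -/
theorem phi1_hereditary (v k s : 𝓢(ℝ, ℝ)) :
    phi1 (phi1 v k) s - phi1 v (phi1 k s) = phi1 (phi1 v s) k - phi1 v (phi1 s k) := by
  ext x
  have hc : mulOp k s = mulOp s k := by
    ext y
    simp only [mulOp_apply, mul_comm]
  rw [phi1_apply (phi1 v k), phi1_apply (phi1 v s), phi1_apply v (phi1 k s),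
    phi1_apply v (phi1 s k)]
  simp only [sub_apply, add_apply, smul_apply, mulInvDx_apply, mulOp_apply, smul_eq_mul,
    invDx_phi1, hc]
  simp only [phi1_apply, map_add, map_smul, dx_mulOp, dx_mulInvDx, add_apply, smul_apply,
    mulInvDx_apply, mulOp_apply, smul_eq_mul]
  ring

theorem phi0_hereditary (u k s : 𝓢(ℝ, ℝ)) :
    phi1 (phi0 u k) s - phi0 u (phi1 k s) = phi1 (phi0 u s) k - phi0 u (phi1 s k) := by
  rw [phi0_apply, phi0_apply, phi0_apply, phi0_apply, phi1_add_left, phi1_add_left]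
  linear_combination (norm := module) phi1_hereditary_dx k s + phi1_hereditary u k s

theorem isPolyMap_kdv (n : ℕ) : IsPolyMap (kdv n) := by
  rw [show kdv n = fun u => dx (gradKdV n u) from funext (kdv_eq_dx_gradKdV n)]
  exact (isPolyMap_gradKdV n).dx

theorem gateaux_kdv (n : ℕ) (u v : 𝓢(ℝ, ℝ)) :
    gateaux (kdv n) u v = dx (gateaux (gradKdV n) u v) := by
  rw [show kdv n = fun u => dx (gradKdV n u) from funext (kdv_eq_dx_gradKdV n)]
  exact gateaux_eq_of_hasCurveDeriv ((isPolyMap_gradKdV n).hasCurveDeriv u v).dx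

theorem gateaux_kdv_zero (u v : 𝓢(ℝ, ℝ)) : gateaux (kdv 0) u v = dx v :=
  gateaux_eq_of_hasCurveDeriv ((hasCurveDeriv_line u v).dx)

theorem gateaux_kdv_succ (n : ℕ) (u v : 𝓢(ℝ, ℝ)) :
    gateaux (kdv (n + 1)) u v = phi1 v (kdv n u) + phi0 u (gateaux (kdv n) u v) := by
  rw [show kdv (n + 1) = fun u => phi0 u (kdv n u) from funext (kdv_succ n)]
  have := (hasCurveDeriv_line u v).phi0 ((isPolyMap_kdv n).hasCurveDeriv u v)
  simp only [zero_smul, add_zero] at this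
  exact gateaux_eq_of_hasCurveDeriv this

/-- For `K_0 = u_x` this is translation invariance of `Φ`. Heredity carries it from `K_n` to `Φ
K_n`. -/
theorem phi0_recursion (n : ℕ) (u s : 𝓢(ℝ, ℝ)) :
    phi1 (kdv n u) s = gateaux (kdv n) u (phi0 u s) - phi0 u (gateaux (kdv n) u s) := by
  induction n generalizing s with
  | zero =>
    rw [gateaux_kdv_zero, gateaux_kdv_zero]
    ext x
    simp only [kdv, pow_zero, Module.End.one_apply, phi0_apply, phi1_apply, map_add, map_smul,
      dx_mulOp, dx_mulInvDx, sub_apply, add_apply, smul_apply, mulOp_apply, mulInvDx_apply,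
      invDx_dx, smul_eq_mul]
    ring
  | succ n ih =>
    rw [gateaux_kdv_succ, gateaux_kdv_succ, kdv_succ, map_add]
    have h1 := phi0_hereditary u (kdv n u) s
    have h2 := congrArg (phi0 u) (ih s)
    rw [map_sub] at h2
    linear_combination (norm := module) h1 + h2

theorem gateaux_kdv_dx (n : ℕ) (u : 𝓢(ℝ, ℝ)) : gateaux (kdv n) u (dx u) = dx (kdv n u) := by
  induction n with
  | zero => exact gateaux_kdv_zero u _
  | succ n ih =>
    have h := phi0_recursion 0 u (kdv n u)
    rw [gateaux_kdv_zero, gateaux_kdv_zero] at h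
    rw [gateaux_kdv_succ, ih, kdv_succ, show dx u = kdv 0 u from rfl, h]
    abel

/-- Since `Φ` is a recursion operator of `K_l`, commuting with `K_m` implies commuting with `Φ K_m`.
-/
theorem gateaux_kdv_comm (l m : ℕ) (u : 𝓢(ℝ, ℝ)) :
    gateaux (kdv l) u (kdv m u) = gateaux (kdv m) u (kdv l u) := by
  induction m with
  | zero => rw [gateaux_kdv_zero]; exact gateaux_kdv_dx l u
  | succ m ih =>
    rw [gateaux_kdv_succ, kdv_succ, ← ih, phi0_recursion]
    abel

end Flows

/-! ### Hamiltonian operators -/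

section Operators

theorem opDeriv_of_affine {E : Type*} [AddCommGroup E] [Module ℝ E] [TopologicalSpace E]
    [T2Space E] {Φ : E → E →ₗ[ℝ] E} {u v s w : E} (h : ∀ t : ℝ, Φ (u + t • v) s = Φ u s + t • w) :
    opDeriv Φ u v s = w := by
  refine gateaux_eq_of_hasCurveDeriv ?_
  simp only [h]
  exact hasCurveDeriv_line _ _

theorem blockOp_apply {E : Type*} [AddCommGroup E] [Module ℝ E] (a b c d : E →ₗ[ℝ] E)
    (x : E × E) : blockOp a b c d x = (a x.1 + b x.2, c x.1 + d x.2) := rfl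

theorem m1_add_left (v v' s : 𝓢(ℝ, ℝ)) : m1 (v + v') s = m1 v s + m1 v' s := by
  ext x
  simp only [m1_apply, add_apply, smul_apply, mulOp_apply, map_add, smul_eq_mul]
  ring

theorem m1_smul_left (c : ℝ) (v s : 𝓢(ℝ, ℝ)) : m1 (c • v) s = c • m1 v s := by
  ext x
  simp only [m1_apply, add_apply, smul_apply, mulOp_apply, map_smul, smul_eq_mul]
  ring

theorem IsPolyMap.m1 {E : Type*} [AddCommGroup E] [Module ℝ E] [TopologicalSpace E]
    {X Y : E → 𝓢(ℝ, ℝ)} (hX : IsPolyMap X) (hY : IsPolyMap Y) :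
    IsPolyMap fun u => m1 (X u) (Y u) := by
  simp only [m1_apply]
  exact ((hX.dx.mulOp hY).smul 2).add ((hX.mulOp hY.dx).smul 4)

theorem IsPolyMap.m0 {E : Type*} [AddCommGroup E] [Module ℝ E] [TopologicalSpace E]
    {X Y : E → 𝓢(ℝ, ℝ)} (hX : IsPolyMap X) (hY : IsPolyMap Y) :
    IsPolyMap fun u => m0 (X u) (Y u) :=
  hY.dx.dx.dx.add (hX.m1 hY)

theorem isPolyMap_fst_fst : IsPolyMap
    fun p : (𝓢(ℝ, ℝ) × 𝓢(ℝ, ℝ)) × (𝓢(ℝ, ℝ) × 𝓢(ℝ, ℝ)) => p.1.1 :=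
  .clm ((ContinuousLinearMap.fst ℝ 𝓢(ℝ, ℝ) 𝓢(ℝ, ℝ)).comp
    (.fst ℝ (𝓢(ℝ, ℝ) × 𝓢(ℝ, ℝ)) (𝓢(ℝ, ℝ) × 𝓢(ℝ, ℝ))))

theorem isPolyMap_fst_snd : IsPolyMap
    fun p : (𝓢(ℝ, ℝ) × 𝓢(ℝ, ℝ)) × (𝓢(ℝ, ℝ) × 𝓢(ℝ, ℝ)) => p.1.2 :=
  .clm ((ContinuousLinearMap.snd ℝ 𝓢(ℝ, ℝ) 𝓢(ℝ, ℝ)).comp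
    (.fst ℝ (𝓢(ℝ, ℝ) × 𝓢(ℝ, ℝ)) (𝓢(ℝ, ℝ) × 𝓢(ℝ, ℝ))))

theorem isPolyMap_snd_fst : IsPolyMap
    fun p : (𝓢(ℝ, ℝ) × 𝓢(ℝ, ℝ)) × (𝓢(ℝ, ℝ) × 𝓢(ℝ, ℝ)) => p.2.1 :=
  .clm ((ContinuousLinearMap.fst ℝ 𝓢(ℝ, ℝ) 𝓢(ℝ, ℝ)).comp
    (.snd ℝ (𝓢(ℝ, ℝ) × 𝓢(ℝ, ℝ)) (𝓢(ℝ, ℝ) × 𝓢(ℝ, ℝ))))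

theorem isPolyMap_snd_snd : IsPolyMap
    fun p : (𝓢(ℝ, ℝ) × 𝓢(ℝ, ℝ)) × (𝓢(ℝ, ℝ) × 𝓢(ℝ, ℝ)) => p.2.2 :=
  .clm ((ContinuousLinearMap.snd ℝ 𝓢(ℝ, ℝ) 𝓢(ℝ, ℝ)).comp
    (.snd ℝ (𝓢(ℝ, ℝ) × 𝓢(ℝ, ℝ)) (𝓢(ℝ, ℝ) × 𝓢(ℝ, ℝ))))

/-- The left-hand side of the Jacobi identity of a scalar operator `L`, for the Lie-Poisson
structure `m1`. -/
def jacobiator (L : 𝓢(ℝ, ℝ) →ₗ[ℝ] 𝓢(ℝ, ℝ)) (a b c : 𝓢(ℝ, ℝ)) : ℝ :=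
  pair a (m1 (L b) c) + pair b (m1 (L c) a) + pair c (m1 (L a) b)

/-- Integrating by parts to remove derivatives from `L a`, `L b`, `L c` leaves twice the cyclic sum
in the hypothesis, which need only be a total derivative. -/
theorem jacobiator_eq_zero_of_potential {L : 𝓢(ℝ, ℝ) →ₗ[ℝ] 𝓢(ℝ, ℝ)} {a b c : 𝓢(ℝ, ℝ)}
    (W : 𝓢(ℝ, ℝ)) (h : ∀ x, L b x * (a x * dx c x - dx a x * c x)
      + L c x * (b x * dx a x - dx b x * a x) + L a x * (c x * dx b x - dx c x * b x) = dx W x) :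
    jacobiator L a b c = 0 := by
  rw [jacobiator, pair_eq_integ, pair_eq_integ, pair_eq_integ, ← map_add, ← map_add,
    show mulOp a (m1 (L b) c) + mulOp b (m1 (L c) a) + mulOp c (m1 (L a) b)
      = dx ((2 : ℝ) • (mulOp (mulOp a c) (L b) + mulOp (mulOp b a) (L c)
        + mulOp (mulOp c b) (L a)) + (2 : ℝ) • W) from ?_, integ_dx]
  ext x
  have := h x
  simp only [m1_apply, map_add, map_smul, dx_mulOp, add_apply, smul_apply, mulOp_apply,
    smul_eq_mul]
  linear_combination 2 * this

theorem jacobiator_dx (a b c : 𝓢(ℝ, ℝ)) : jacobiator dx a b c = 0 :=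
  jacobiator_eq_zero_of_potential 0 fun x => by
    simp only [map_zero, zero_apply]
    ring

theorem jacobiator_m1 (v a b c : 𝓢(ℝ, ℝ)) : jacobiator (m1 v) a b c = 0 :=
  jacobiator_eq_zero_of_potential 0 fun x => by
    simp only [map_zero, zero_apply, m1_apply, add_apply, smul_apply, mulOp_apply, smul_eq_mul]
    ring

theorem jacobiator_m0 (u a b c : 𝓢(ℝ, ℝ)) : jacobiator (m0 u) a b c = 0 :=
  jacobiator_eq_zero_of_potential
    -- Differentiating `b_xx (a c_x - a_x c)` gives the third-order term and `b_xx (a c_xx - a_xx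
    -- c)`; the latter cancels in the cyclic sum.
    (mulOp (dx (dx b)) (mulOp a (dx c) - mulOp (dx a) c)
      + mulOp (dx (dx c)) (mulOp b (dx a) - mulOp (dx b) a)
      + mulOp (dx (dx a)) (mulOp c (dx b) - mulOp (dx c) b)) fun x => by
    simp only [m0_apply, m1_apply, map_add, map_sub, dx_mulOp, add_apply, sub_apply, smul_apply,
      mulOp_apply, smul_eq_mul]
    ring

/-- The family of operators with off-diagonal entry `p ∂ + q M₀` and lower diagonal entry
`r ∂ + s M₀ + q M₁`. -/
def pencil (p q r s : ℝ) (η : 𝓢(ℝ, ℝ) × 𝓢(ℝ, ℝ)) :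
    𝓢(ℝ, ℝ) × 𝓢(ℝ, ℝ) →ₗ[ℝ] 𝓢(ℝ, ℝ) × 𝓢(ℝ, ℝ) :=
  blockOp 0 (p • dx + q • m0 η.1) (p • dx + q • m0 η.1) (r • dx + s • m0 η.1 + q • m1 η.2)

theorem pencil_apply (p q r s : ℝ) (η x : 𝓢(ℝ, ℝ) × 𝓢(ℝ, ℝ)) :
    pencil p q r s η x = (p • dx x.2 + q • m0 η.1 x.2,
      p • dx x.1 + q • m0 η.1 x.1 + (r • dx x.2 + s • m0 η.1 x.2 + q • m1 η.2 x.2)) := by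
  simp [pencil, blockOp_apply]

theorem opDeriv_pencil (p q r s : ℝ) (η v x : 𝓢(ℝ, ℝ) × 𝓢(ℝ, ℝ)) :
    opDeriv (pencil p q r s) η v x
      = (q • m1 v.1 x.2, q • m1 v.1 x.1 + (s • m1 v.1 x.2 + q • m1 v.2 x.2)) := by
  refine opDeriv_of_affine fun t => ?_
  simp only [pencil_apply, m0_apply, Prod.fst_add, Prod.snd_add, Prod.smul_fst, Prod.smul_snd,
    m1_add_left, m1_smul_left]
  ext1
  · simp only [Prod.fst_add, Prod.smul_fst]
    module
  · simp only [Prod.snd_add, Prod.smul_snd]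
    module

/-- The derivative of the operator involves only `m1`, so the Jacobi sum is a combination of scalar
jacobiators of `∂`, `M₀` and `M₁`, all zero. The `q²` terms with one first-component argument and
the `M₁` term together are the linearised Jacobi identity of `M`. -/
theorem isHamiltonianOp_pencil (p q r s : ℝ) : IsHamiltonianOp pair2 (pencil p q r s) := by
  refine ⟨?_, fun η a b => ?_, fun η a b c => ?_⟩
  · have h1 := isPolyMap_fst_fst
    have h2 := isPolyMap_fst_snd
    have h3 := isPolyMap_snd_fst
    have h4 := isPolyMap_snd_snd
    unfold IsSmoothOp
    simp only [pencil_apply]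
    exact ((h4.dx.smul p).add ((h1.m0 h4).smul q)).isSmooth.prodMk
      (((h3.dx.smul p).add ((h1.m0 h3).smul q)).add
        (((h4.dx.smul r).add ((h1.m0 h4).smul s)).add ((h2.m1 h4).smul q))).isSmooth
  · simp only [pencil_apply, pair2, pair_add_right, pair_smul_right]
    rw [pair_dx_skew a.1, pair_dx_skew a.2 b.1, pair_dx_skew a.2 b.2, pair_m0_skew _ a.1,
      pair_m0_skew _ a.2 b.1, pair_m0_skew _ a.2 b.2, pair_m1_skew _ a.2]
    ring
  · simp only [opDeriv_pencil, pencil_apply, pair2, pair_add_right, pair_smul_right, m1_add_left,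
      m1_smul_left]
    have h1 := fun a b c => jacobiator_dx a b c
    have h2 := fun a b c => jacobiator_m0 η.1 a b c
    have h3 := fun a b c => jacobiator_m1 η.2 a b c
    simp only [jacobiator] at h1 h2 h3
    linear_combination q * p * (h1 a.1 b.2 c.2 + h1 b.1 c.2 a.2 + h1 c.1 a.2 b.2)
      + q * q * (h2 a.1 b.2 c.2 + h2 b.1 c.2 a.2 + h2 c.1 a.2 b.2)
      + (q * r + s * p) * h1 a.2 b.2 c.2 + 2 * (q * s) * h2 a.2 b.2 c.2
      + q * q * h3 a.2 b.2 c.2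

theorem nonstdOps_eq_pencil (α : ℝ) (i : Fin 4) :
    ∃ p q r s, nonstdOps α i = pencil p q r s := by
  fin_cases i
  · exact ⟨1, 0, 0, 0, by funext η; simp [nonstdOps, pencil]⟩
  · exact ⟨0, 1, 0, 0, by funext η; simp [nonstdOps, pencil]⟩
  · exact ⟨1, 0, α, 0, by funext η; simp [nonstdOps, pencil]⟩
  · exact ⟨0, 1, 0, α, by funext η; simp [nonstdOps, pencil, add_comm]⟩

theorem isHamiltonianPair_nonstdOps (α : ℝ) (i j : Fin 4) :
    IsHamiltonianPair pair2 (nonstdOps α i) (nonstdOps α j) := by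
  obtain ⟨p, q, r, s, h⟩ := nonstdOps_eq_pencil α i
  obtain ⟨p', q', r', s', h'⟩ := nonstdOps_eq_pencil α j
  intro c d
  rw [h, h']
  have : (fun η => c • pencil p q r s η + d • pencil p' q' r' s' η)
      = pencil (c * p + d * p') (c * q + d * q') (c * r + d * r') (c * s + d * s') := by
    funext η
    refine LinearMap.ext fun x => ?_
    simp only [LinearMap.add_apply, LinearMap.smul_apply, pencil_apply]
    ext1
    · simp only [Prod.fst_add, Prod.smul_fst]
      module
    · simp only [Prod.snd_add, Prod.smul_snd]
      module
  rw [this]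
  exact isHamiltonianOp_pencil _ _ _ _

theorem isHamiltonianOp_nonstdOps (α : ℝ) (i : Fin 4) :
    IsHamiltonianOp pair2 (nonstdOps α i) := by
  obtain ⟨p, q, r, s, h⟩ := nonstdOps_eq_pencil α i
  exact h ▸ isHamiltonianOp_pencil p q r s

theorem isHamiltonianOp_dx : IsHamiltonianOp pair fun _ => dx := by
  have h : ∀ u v s : 𝓢(ℝ, ℝ), opDeriv (fun _ : 𝓢(ℝ, ℝ) => dx) u v s = 0 := fun u v s =>
    opDeriv_of_affine fun t => by simp
  refine ⟨?_, fun _ => pair_dx_skew, fun u a b c => ?_⟩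
  · exact (IsPolyMap.clm (.snd ℝ 𝓢(ℝ, ℝ) 𝓢(ℝ, ℝ))).dx.isSmooth
  · simp only [h, pair_zero_right, add_zero]

end Operators

/-! ### The perturbation system -/

section System

theorem hasCurveDeriv_kdvPer (n : ℕ) (α : ℝ) (η₀ η₁ : 𝓢(ℝ, ℝ)) :
    HasCurveDeriv (fun ε : ℝ => kdvPer n α ε (η₀ + ε • η₁))
      (gateaux (kdv n) η₀ η₁ + α • kdv n η₀) := by
  have h := (isPolyMap_kdv n).hasCurveDeriv η₀ η₁
  refine h.add ?_
  -- The second summand vanishes at `ε = 0` and carries a factor `ε`, so its difference quotient is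
  -- `α K_n` along the curve and continuity suffices.
  have h2 := (h.tendsto.const_smul α)
  rw [zero_smul, add_zero] at h2
  refine h2.congr' ?_
  filter_upwards [self_mem_nhdsWithin] with t ht
  have ht' : t ≠ 0 := ht
  have : t⁻¹ * (α * t) = α := by field_simp
  simp [smul_smul, this]

theorem nonstdField_apply (n : ℕ) (α : ℝ) (η : 𝓢(ℝ, ℝ) × 𝓢(ℝ, ℝ)) :
    nonstdField n α η
      = (kdv n η.1, gateaux (kdv n) η.1 η.2 + α • kdv n η.1) := by
  rw [nonstdField, perField, (hasCurveDeriv_kdvPer n α η.1 η.2).curveDeriv]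
  simp [kdvPer]

theorem isSmooth_nonstdField (n : ℕ) (α : ℝ) : IsSmooth (nonstdField n α) := by
  rw [funext (nonstdField_apply n α)]
  have h : IsPolyMap fun η : 𝓢(ℝ, ℝ) × 𝓢(ℝ, ℝ) => kdv n η.1 :=
    (isPolyMap_kdv n).precomp (.fst ℝ 𝓢(ℝ, ℝ) 𝓢(ℝ, ℝ))
  exact h.isSmooth.prodMk ((isPolyMap_kdv n).tangent.add (h.smul α)).isSmooth

theorem gateaux_nonstdField (n : ℕ) (α : ℝ) (η s : 𝓢(ℝ, ℝ) × 𝓢(ℝ, ℝ)) :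
    gateaux (nonstdField n α) η s = (gateaux (kdv n) η.1 s.1,
      hess (kdv n) η.1 η.2 s.1 + gateaux (kdv n) η.1 s.2 + α • gateaux (kdv n) η.1 s.1) := by
  have h := isPolyMap_kdv n
  have h1 := h.hasCurveDeriv η.1 s.1
  have h2 := h.hasCurveDeriv_gateaux (hasCurveDeriv_line η.1 s.1) (hasCurveDeriv_line η.2 s.2)
  simp only [zero_smul, add_zero] at h2
  rw [funext (nonstdField_apply n α)]
  exact gateaux_eq_of_hasCurveDeriv (h1.prodMk (h2.add (h1.const_smul α)))

/-- The recursion identity differentiated with respect to `u`. -/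
theorem phi0_recursion_deriv (n : ℕ) (u v s : 𝓢(ℝ, ℝ)) :
    phi1 (gateaux (kdv n) u v) s
      = hess (kdv n) u (phi0 u s) v + gateaux (kdv n) u (phi1 v s)
        - (phi1 v (gateaux (kdv n) u s) + phi0 u (hess (kdv n) u s v)) := by
  have h := isPolyMap_kdv n
  have hl := hasCurveDeriv_line u v
  have hs := hasCurveDeriv_const s
  have h1 := (h.hasCurveDeriv u v).phi1 hs
  have h2 := h.hasCurveDeriv_gateaux hl (hl.phi0 hs)
  have h3 := hl.phi0 (h.hasCurveDeriv_gateaux hl hs)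
  simp only [phi0_recursion] at h1
  have h4 := h1.unique (h2.sub h3)
  simpa only [zero_smul, add_zero, map_zero, h.gateaux_zero, sub_zero] using h4

theorem phiHat1_apply (β₀ β₁ : ℝ) (η s : 𝓢(ℝ, ℝ) × 𝓢(ℝ, ℝ)) :
    phiHat1 β₀ β₁ η s = (β₀ • s.1, β₁ • s.1 + β₀ • s.2) := by
  simp [phiHat1, blockOp_apply]

theorem opDeriv_phiHat1 (β₀ β₁ : ℝ) (η v s : 𝓢(ℝ, ℝ) × 𝓢(ℝ, ℝ)) :
    opDeriv (phiHat1 β₀ β₁) η v s = 0 :=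
  opDeriv_of_affine fun t => by simp [phiHat1_apply]

theorem isSmoothOp_phiHat1 (β₀ β₁ : ℝ) : IsSmoothOp (phiHat1 β₀ β₁) := by
  have h3 := isPolyMap_snd_fst
  have h4 := isPolyMap_snd_snd
  unfold IsSmoothOp
  simp only [phiHat1_apply]
  exact (h3.smul β₀).isSmooth.prodMk ((h3.smul β₁).add (h4.smul β₀)).isSmooth

theorem isHereditary_phiHat1 (β₀ β₁ : ℝ) : IsHereditary (phiHat1 β₀ β₁) :=
  ⟨isSmoothOp_phiHat1 β₀ β₁, fun u k s => by simp [opDeriv_phiHat1]⟩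

theorem isRecursionOperator_phiHat1 (n : ℕ) (α β₀ β₁ : ℝ) :
    IsRecursionOperator (nonstdField n α) (phiHat1 β₀ β₁) := by
  refine ⟨isSmoothOp_phiHat1 β₀ β₁, fun η s => ?_⟩
  have h := isPolyMap_kdv n
  simp only [opDeriv_phiHat1, gateaux_nonstdField, phiHat1_apply, h.gateaux_add, h.gateaux_smul,
    h.hess_smul]
  ext1
  · simp
  · simp only [Prod.snd_add, Prod.snd_sub, Prod.snd_zero]
    module

theorem phiHat2_apply (β₀ β₁ : ℝ) (η s : 𝓢(ℝ, ℝ) × 𝓢(ℝ, ℝ)) :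
    phiHat2 β₀ β₁ η s = (β₀ • phi0 η.1 s.1,
      β₀ • phi1 η.2 s.1 + β₁ • phi0 η.1 s.1 + β₀ • phi0 η.1 s.2) := by
  simp [phiHat2, blockOp_apply]

theorem opDeriv_phiHat2 (β₀ β₁ : ℝ) (η v s : 𝓢(ℝ, ℝ) × 𝓢(ℝ, ℝ)) :
    opDeriv (phiHat2 β₀ β₁) η v s = (β₀ • phi1 v.1 s.1,
      β₀ • phi1 v.2 s.1 + β₁ • phi1 v.1 s.1 + β₀ • phi1 v.1 s.2) := by
  refine opDeriv_of_affine fun t => ?_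
  simp only [phiHat2_apply, phi0_apply, Prod.fst_add, Prod.snd_add, Prod.smul_fst, Prod.smul_snd,
    phi1_add_left, phi1_smul_left]
  ext1
  · simp only [Prod.fst_add, Prod.smul_fst]
    module
  · simp only [Prod.snd_add, Prod.smul_snd]
    module

theorem isSmoothOp_phiHat2 (β₀ β₁ : ℝ) : IsSmoothOp (phiHat2 β₀ β₁) := by
  have h1 := isPolyMap_fst_fst
  have h2 := isPolyMap_fst_snd
  have h3 := isPolyMap_snd_fst
  have h4 := isPolyMap_snd_snd
  unfold IsSmoothOp
  simp only [phiHat2_apply]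
  exact ((h1.phi0 h3).smul β₀).isSmooth.prodMk
    ((((h2.phi1 h3).smul β₀).add ((h1.phi0 h3).smul β₁)).add ((h1.phi0 h4).smul β₀)).isSmooth

theorem isHereditary_phiHat2 (β₀ β₁ : ℝ) : IsHereditary (phiHat2 β₀ β₁) := by
  refine ⟨isSmoothOp_phiHat2 β₀ β₁, fun η k s => ?_⟩
  simp only [opDeriv_phiHat2, phiHat2_apply, map_add, map_smul, phi1_add_left, phi1_smul_left]
  have h := phi0_hereditary η.1
  ext1
  · simp only [Prod.fst_add, Prod.fst_sub, Prod.fst_zero]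
    linear_combination (norm := module) (β₀ * β₀) • h k.1 s.1
  · simp only [Prod.snd_add, Prod.snd_sub, Prod.snd_zero]
    -- The `β₀²` part is scalar heredity linearised in all its arguments; the derivative in `u` is
    -- the identity `phi1_hereditary` at `η₁`.
    linear_combination (norm := module) (β₀ * β₀) • (h k.1 s.2 + h k.2 s.1
      + phi1_hereditary η.2 k.1 s.1) + (2 * (β₀ * β₁)) • h k.1 s.1

theorem isRecursionOperator_phiHat2 (n : ℕ) (α β₀ β₁ : ℝ) :
    IsRecursionOperator (nonstdField n α) (phiHat2 β₀ β₁) := by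
  refine ⟨isSmoothOp_phiHat2 β₀ β₁, fun η s => ?_⟩
  have h := isPolyMap_kdv n
  simp only [opDeriv_phiHat2, gateaux_nonstdField, phiHat2_apply, nonstdField_apply,
    h.gateaux_add, h.gateaux_smul, h.hess_smul, map_add, map_smul, phi1_add_left, phi1_smul_left]
  have e := phi0_recursion n η.1
  have e' := phi0_recursion_deriv n η.1 η.2 s.1
  rw [h.hess_comm _ _ η.2, h.hess_comm _ _ η.2] at e'
  ext1
  · simp only [Prod.fst_add, Prod.fst_sub, Prod.fst_zero]
    linear_combination (norm := module) β₀ • e s.1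
  · simp only [Prod.snd_add, Prod.snd_sub, Prod.snd_zero]
    -- The recursion identity differentiated along `η₁`, plus the plain identity at both components
    -- of `s`.
    linear_combination (norm := module) β₀ • e' + (β₁ + α * β₀) • e s.1 + β₀ • e s.2

end System

/-! ### Independence of the KdV flows -/

section Independence

open MvPolynomial

/-- Differential polynomials in the first function of order less than `k`. -/
abbrev lowOrder (k : ℕ) : Subalgebra ℝ DiffPoly :=
  supported ℝ {i : Fin 2 × ℕ | i.1 = 0 ∧ i.2 < k}

theorem lowOrder_mono {k l : ℕ} (h : k ≤ l) : lowOrder k ≤ lowOrder l :=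
  supported_mono fun _ hi => ⟨hi.1, hi.2.trans_le h⟩

theorem X_mem_lowOrder {j k : ℕ} (h : j < k) : (X (0, j) : DiffPoly) ∈ lowOrder k :=
  X_mem_supported.2 ⟨rfl, h⟩

theorem totalD_mem_lowOrder {k : ℕ} {p : DiffPoly} (hp : p ∈ lowOrder k) :
    totalD p ∈ lowOrder (k + 1) :=
  totalD_mem_supported (s := {i : Fin 2 × ℕ | i.1 = 0 ∧ i.2 < k})
    (t := {i : Fin 2 × ℕ | i.1 = 0 ∧ i.2 < k + 1})
    (fun _ hi => ⟨hi.1, hi.2.trans (Nat.lt_succ_self _)⟩)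
    (fun _ hi => ⟨hi.1, Nat.succ_lt_succ hi.2⟩) hp

/-- Among the terms defining `f_{n+2}` only `∂² f_{n+1}` reaches order `2(n+2)`. -/
theorem exists_resolvent_eq_add (n : ℕ) :
    ∃ q ∈ lowOrder (2 * n), (resolvent totalD (X (0, 0)) n : DiffPoly) = X (0, 2 * n) + q := by
  induction n using Nat.strong_induction_on with
  | _ n ih =>
    have hlow : ∀ k, k < n → (resolvent totalD (X (0, 0)) k : DiffPoly) ∈ lowOrder (2 * k + 1) :=
      fun k hk => by
        obtain ⟨q, hq, e⟩ := ih k hk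
        rw [e]
        exact add_mem (X_mem_lowOrder (by omega)) (lowOrder_mono (by omega) hq)
    have hDD : ∀ k, k < n → totalD (totalD (resolvent totalD (X (0, 0)) k : DiffPoly))
        ∈ lowOrder (2 * k + 3) :=
      fun k hk => totalD_mem_lowOrder (totalD_mem_lowOrder (hlow k hk))
    match n with
    | 0 => exact ⟨0, zero_mem _, by simp [resolvent]⟩
    | 1 =>
      refine ⟨3 * X (0, 0) ^ 2, mul_mem (ofNat_mem _ 3) (pow_mem (X_mem_lowOrder (by omega)) 2), ?_⟩
      rw [resolvent, totalD_X, totalD_X]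
    | n + 2 =>
      obtain ⟨q, hq, e⟩ := ih (n + 1) (by omega)
      have hq' : totalD (totalD q) ∈ lowOrder (2 * (n + 2)) :=
        totalD_mem_lowOrder (totalD_mem_lowOrder hq)
      have h0 : (X (0, 0) : DiffPoly) ∈ lowOrder (2 * (n + 2)) := X_mem_lowOrder (by omega)
      have hl : ∀ k, k < n + 2 →
          (resolvent totalD (X (0, 0)) k : DiffPoly) ∈ lowOrder (2 * (n + 2)) :=
        fun k hk => lowOrder_mono (by omega) (hlow k hk)
      have hl1 : ∀ k, k < n + 1 →
          totalD (resolvent totalD (X (0, 0)) k : DiffPoly) ∈ lowOrder (2 * (n + 2)) :=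
        fun k hk => lowOrder_mono (by omega) (totalD_mem_lowOrder (hlow k (by omega)))
      have hl2 : ∀ k, k < n + 1 →
          totalD (totalD (resolvent totalD (X (0, 0)) k : DiffPoly)) ∈ lowOrder (2 * (n + 2)) :=
        fun k hk => lowOrder_mono (by omega) (hDD k (by omega))
      have h2 : (2 : DiffPoly) ∈ lowOrder (2 * (n + 2)) := ofNat_mem _ 2
      have h4 : (4 : DiffPoly) ∈ lowOrder (2 * (n + 2)) := ofNat_mem _ 4
      have hs1 : ∑ i : Fin (n + 2), (resolvent totalD (X (0, 0)) i : DiffPoly)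
          * resolvent totalD (X (0, 0)) (n + 1 - i) ∈ lowOrder (2 * (n + 2)) :=
        sum_mem fun i _ => mul_mem (hl _ (by omega)) (hl _ (by omega))
      have hs2 : ∑ i : Fin (n + 1), (2 * (resolvent totalD (X (0, 0)) i : DiffPoly)
            * totalD (totalD (resolvent totalD (X (0, 0)) (n - i)))
          - totalD (resolvent totalD (X (0, 0)) i) * totalD (resolvent totalD (X (0, 0)) (n - i))
          + 4 * X (0, 0) * resolvent totalD (X (0, 0)) i * resolvent totalD (X (0, 0)) (n - i))
          ∈ lowOrder (2 * (n + 2)) := by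
        refine sum_mem fun i _ => ?_
        have a1 := hl i (by omega)
        have a2 := hl (n - i) (by omega)
        exact add_mem (sub_mem (mul_mem (mul_mem h2 a1) (hl2 _ (by omega)))
          (mul_mem (hl1 _ (by omega)) (hl1 _ (by omega)))) (mul_mem (mul_mem (mul_mem h4 h0) a1) a2)
      refine ⟨_, add_mem (sub_mem (add_mem hq' (mul_mem (mul_mem h4 h0) (hl (n + 1) (by omega))))
        hs1) hs2, ?_⟩
      rw [resolvent]
      have e2 : totalD (totalD (resolvent totalD (X (0, 0)) (n + 1) : DiffPoly))
          = X (0, 2 * (n + 2)) + totalD (totalD q) := by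
        rw [e, map_add, map_add, totalD_X, totalD_X]
        rfl
      rw [e2]
      ring

theorem kdv_apply (n : ℕ) (u : 𝓢(ℝ, ℝ)) (x : ℝ) :
    kdv n u x = aeval (jet (u, 0) x) (totalD (resolvent totalD (X (0, 0)) n)) := by
  rw [kdv_eq_dx_gradKdV, gradKdV, dx_jetEval, jetEval_apply, constantCoeff_totalD, sub_zero]

/-- If the derivatives of `u` of order less than `2 n + 1` vanish at `x`, then `K_n(u)` reduces at
`x` to its linear part. -/
theorem kdv_apply_of_vanishing {n : ℕ} {u : 𝓢(ℝ, ℝ)} {x : ℝ}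
    (h : ∀ k, k < 2 * n + 1 → (dx ^ k) u x = 0) : kdv n u x = (dx ^ (2 * n + 1)) u x := by
  obtain ⟨q, hq, e⟩ := exists_resolvent_eq_add n
  rw [kdv_apply, e, map_add, map_add, totalD_X, aeval_X,
    aeval_eq_of_mem_supported (totalD_mem_lowOrder hq) (g := 0)
      (fun i hi => by
        have h1 : i.1 = 0 := hi.1
        simpa [jet, h1] using h i.2 hi.2)]
  simp [aeval_zero, constantCoeff_totalD, jet]

theorem exists_schwartz_monomial (j : ℕ) (m : ℕ) : ∃ g : 𝓢(ℝ, ℝ),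
    (∀ᶠ x in 𝓝 (j : ℝ), g x = (x - j) ^ m) ∧ ∀ i : ℕ, i ≠ j → ∀ᶠ x in 𝓝 (i : ℝ), g x = 0 := by
  let φ : ContDiffBump (j : ℝ) := ⟨1 / 4, 1 / 2, by norm_num, by norm_num⟩
  have hs : HasCompactSupport fun x : ℝ => φ x * (x - j) ^ m := φ.hasCompactSupport.mul_right
  have hc : ContDiff ℝ ((⊤ : ℕ∞) : WithTop ℕ∞) fun x : ℝ => φ x * (x - j) ^ m :=
    φ.contDiff.mul ((contDiff_id.sub contDiff_const).pow m)
  refine ⟨hs.toSchwartzMap hc, ?_, fun i hij => ?_⟩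
  · filter_upwards [φ.eventuallyEq_one] with x hx
    change φ x * (x - j) ^ m = _
    rw [hx]
    simp
  · filter_upwards [Metric.ball_mem_nhds (i : ℝ) (show (0 : ℝ) < 1 / 2 by norm_num)] with x hx
    change φ x * (x - j) ^ m = 0
    rw [φ.zero_of_le_dist, zero_mul]
    change 1 / 2 ≤ dist x j
    have h1 : (1 : ℝ) ≤ dist (i : ℝ) (j : ℝ) := by
      rw [Nat.dist_cast_real]
      exact Nat.pairwise_one_le_dist hij
    have h2 := dist_triangle (i : ℝ) x j
    rw [Metric.mem_ball, dist_comm] at hx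
    linarith

theorem dx_pow_eventuallyEq {u : 𝓢(ℝ, ℝ)} {y : ℝ} {m : ℕ}
    (h : ∀ᶠ x in 𝓝 y, u x = (x - y) ^ m) (k : ℕ) :
    (dx ^ k) u =ᶠ[𝓝 y] fun x => (m.descFactorial k : ℝ) * (x - y) ^ (m - k) := by
  induction k with
  | zero => simpa [EventuallyEq] using h
  | succ k ih =>
    have e : ((dx ^ (k + 1)) u : ℝ → ℝ) = deriv ((dx ^ k) u) := by
      rw [pow_succ']
      rfl
    rw [e]
    refine ih.deriv.trans (Eventually.of_forall fun x => ?_)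
    have hd : HasDerivAt (fun x => (m.descFactorial k : ℝ) * (x - y) ^ (m - k))
        ((m.descFactorial k : ℝ) * ((m - k : ℕ) * (x - y) ^ (m - k - 1) * 1)) x :=
      ((((hasDerivAt_id x).sub_const y).pow (m - k))).const_mul _
    rw [hd.deriv, Nat.descFactorial_succ, Nat.sub_sub]
    push_cast
    ring

/-- Near each integer `j < N` the function `u` equals `(x - j)^(2j+1)`. At `j` its first nonzero
derivative is exactly the one in the linear leading term of `K_j`, with value `(2j+1)!`, and every
earlier flow vanishes there. -/
theorem exists_triangular (N : ℕ) : ∃ u : 𝓢(ℝ, ℝ),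
    ∀ j : ℕ, j < N → kdv j u j ≠ 0 ∧ ∀ m < j, kdv m u j = 0 := by
  choose g hg hg' using fun j : ℕ => exists_schwartz_monomial j (2 * j + 1)
  refine ⟨∑ j ∈ Finset.range N, g j, fun j hj => ?_⟩
  set u := ∑ j ∈ Finset.range N, g j with hu
  have hloc : ∀ᶠ x in 𝓝 (j : ℝ), u x = (x - j) ^ (2 * j + 1) := by
    have h1 : ∀ᶠ x in 𝓝 (j : ℝ), ∀ i ∈ Finset.range N, i ≠ j → g i x = 0 := by
      rw [Filter.eventually_all_finset]
      intro i _
      by_cases hij : i = j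
      · simp [hij]
      · filter_upwards [hg' i j (Ne.symm hij)] with x hx _ using hx
    filter_upwards [h1, hg j] with x hx hx'
    have : u x = ∑ i ∈ Finset.range N, g i x := by
      change evalAt x u = _
      rw [hu, map_sum]
      rfl
    rw [this, Finset.sum_eq_single j (fun i hi hij => hx i hi hij)
      (fun h => absurd (Finset.mem_range.2 hj) h), hx']
  have hjet : ∀ k, (dx ^ k) u j = ((2 * j + 1).descFactorial k : ℝ) * 0 ^ (2 * j + 1 - k) :=
    fun k => by
      have := (dx_pow_eventuallyEq hloc k).self_of_nhds
      simpa using this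
  have hlow : ∀ k, k < 2 * j + 1 → (dx ^ k) u j = 0 := fun k hk => by
    rw [hjet, zero_pow (by omega), mul_zero]
  refine ⟨?_, fun m hm => ?_⟩
  · rw [kdv_apply_of_vanishing hlow, hjet, Nat.sub_self, pow_zero, mul_one]
    exact_mod_cast (Nat.descFactorial_pos.2 le_rfl).ne'
  · rw [kdv_apply_of_vanishing fun k hk => hlow k (by omega)]
    exact hlow _ (by omega)

/-- The matrix of values of the first `N` flows at the points `0, …, N - 1`. -/
def flowMatrix (N : ℕ) (u : 𝓢(ℝ, ℝ)) : Matrix (Fin N) (Fin N) ℝ :=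
  Matrix.of fun m j => kdv m u (j : ℕ)

theorem linearIndependent_kdv_of_det {N : ℕ} {u : 𝓢(ℝ, ℝ)} (h : (flowMatrix N u).det ≠ 0) :
    LinearIndependent ℝ fun m : Fin N => kdv m u := by
  let L : 𝓢(ℝ, ℝ) →ₗ[ℝ] (Fin N → ℝ) :=
    LinearMap.pi fun j => (evalAt ((j : ℕ) : ℝ)).toLinearMap
  exact LinearIndependent.of_comp L (Matrix.linearIndependent_rows_of_det_ne_zero h)

theorem exists_polynomial_kdv (m : ℕ) (u w : 𝓢(ℝ, ℝ)) (x : ℝ) :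
    ∃ P : Polynomial ℝ, ∀ t : ℝ, P.eval t = kdv m (u + t • w) x := by
  refine ⟨aeval (fun i => Polynomial.C (jet (u, 0) x i) + Polynomial.X
    * Polynomial.C (jet (w, 0) x i)) (totalD (resolvent totalD (X (0, 0)) m) : DiffPoly),
    fun t => ?_⟩
  rw [kdv_apply]
  have := MvPolynomial.comp_aeval_apply (R := ℝ) (fun i => Polynomial.C (jet (u, 0) x i)
    + Polynomial.X * Polynomial.C (jet (w, 0) x i)) (Polynomial.aeval t)
    (totalD (resolvent totalD (X (0, 0)) m) : DiffPoly)
  rw [Polynomial.coe_aeval_eq_eval] at this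
  rw [this]
  congr 2
  funext i
  by_cases hi : i.1 = 0 <;> simp [jet, hi, mul_comm t]

/-- On the line from any `u` to the triangular example the determinant of flow values is a
polynomial in `t`, nonzero at `t = 1`. Its roots are finite in number, so `t = 0` is a limit of
independent points. -/
theorem dense_linearIndependent_kdv (N : ℕ) :
    Dense {u : 𝓢(ℝ, ℝ) | LinearIndependent ℝ fun m : Fin N => kdv m u} := by
  obtain ⟨u₁, h₁⟩ := exists_triangular N
  have hdet : (flowMatrix N u₁).det ≠ 0 := by
    rw [Matrix.det_of_isLowerTriangular (flowMatrix N u₁)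
      fun i j hij => (h₁ j j.2).2 i hij]
    exact Finset.prod_ne_zero_iff.2 fun i _ => (h₁ i i.2).1
  intro u
  choose P hP using fun (m j : Fin N) => exists_polynomial_kdv m u (u₁ - u) (j : ℕ)
  let Q : Polynomial ℝ := (Matrix.of P).det
  have hQ : ∀ t, Q.eval t = (flowMatrix N (u + t • (u₁ - u))).det := fun t => by
    rw [← Polynomial.coe_evalRingHom, RingHom.map_det]
    congr 1
    ext m j
    exact hP m j t
  have hQ0 : Q ≠ 0 := fun h => hdet (by
    have := hQ 1
    rw [h, Polynomial.eval_zero, one_smul, add_sub_cancel] at this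
    exact this.symm)
  have hfin : {t : ℝ | Q.IsRoot t}.Finite := Polynomial.finite_setOfPred_isRoot hQ0
  have hd : (0 : ℝ) ∈ closure {t : ℝ | Q.IsRoot t}ᶜ := hfin.countable.dense_compl ℝ 0
  have hc : Continuous fun t : ℝ => u + t • (u₁ - u) := by fun_prop
  have := map_mem_closure hc hd (t := {u | LinearIndependent ℝ fun m : Fin N => kdv m u})
    fun t ht => linearIndependent_kdv_of_det (by rw [← hQ]; exact ht)
  simpa using this

end Independence

/-! ### Integrability -/

section Integrability

theorem isIntegrable_kdv (n : ℕ) : IsIntegrable pair (kdv n) := by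
  have e : ∀ m, (fun u : 𝓢(ℝ, ℝ) => dx (gradKdV m u)) = kdv m := fun m =>
    funext fun u => (kdv_eq_dx_gradKdV m u).symm
  refine ⟨(isPolyMap_kdv n).isSmooth, fun _ => dx, hamKdV n, hamKdV, gradKdV,
    ⟨isHamiltonianOp_dx, gradKdV n, isVariationalDerivative_hamKdV n, kdv_eq_dx_gradKdV n⟩,
    isVariationalDerivative_hamKdV, fun m u => ?_, fun l m u => pair_gradKdV_dx l m u,
    fun m u => ?_, fun l m u => ?_, fun N => ?_⟩
  · rw [kdv_eq_dx_gradKdV]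
    exact pair_gradKdV_dx m n u
  · simp only [e]
    rw [commutator, gateaux_kdv_comm, sub_self]
  · simp only [e]
    rw [commutator, gateaux_kdv_comm, sub_self]
  · simp only [← kdv_eq_dx_gradKdV]
    exact dense_linearIndependent_kdv N

theorem isHamiltonianForm_nonstdField {n : ℕ} (hn : 1 ≤ n) (α : ℝ) (i : Fin 4) :
    IsHamiltonianForm pair2 (nonstdField n α) (nonstdOps α i) (nonstdHams n α i) := by
  refine ⟨isHamiltonianOp_nonstdOps α i, ?_⟩
  obtain ⟨k, rfl⟩ : ∃ k, n = k + 1 := ⟨n - 1, by omega⟩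
  have h1 : ∀ m, IsVariationalDerivative pair2 (fun η => perFunctional (hamKdV m) η)
      (gradPer m 0) := fun m => by simpa using isVariationalDerivative_per m 0
  have hK : ∀ u, kdv (k + 1) u = m0 u (gradKdV k u) := fun u => by
    rw [kdv_eq_dx_gradKdV, dx_gradKdV_succ_eq_m0]
  -- The derivative of `K_{k+1} = M f_k`; it produces the `M₁` entry of the second and fourth
  -- operators.
  have hg : ∀ u v, gateaux (kdv (k + 1)) u v
      = m0 u (gateaux (gradKdV k) u v) + m1 v (gradKdV k u) := fun u v => by
    rw [gateaux_kdv_succ, gateaux_kdv, kdv_eq_dx_gradKdV, phi0_dx, phi1_dx, add_comm]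
  fin_cases i
  · refine ⟨gradPer (k + 1) α, isVariationalDerivative_per _ α, fun η => ?_⟩
    simp [nonstdField_apply, nonstdOps, blockOp_apply, gradPer, gateaux_kdv, kdv_eq_dx_gradKdV]
  · refine ⟨gradPer k α, isVariationalDerivative_per _ α, fun η => ?_⟩
    simp only [nonstdField_apply, hK, hg]
    simp [nonstdOps, blockOp_apply, gradPer]
    abel
  · refine ⟨gradPer (k + 1) 0, h1 _, fun η => ?_⟩
    simp [nonstdField_apply, nonstdOps, blockOp_apply, gradPer, gateaux_kdv, kdv_eq_dx_gradKdV]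
  · refine ⟨gradPer k 0, h1 _, fun η => ?_⟩
    simp only [nonstdField_apply, hK, hg]
    simp [nonstdOps, blockOp_apply, gradPer]
    abel

/-- The commutation of the flows differentiated with respect to `u`. -/
theorem hess_kdv_comm (l m : ℕ) (u v : 𝓢(ℝ, ℝ)) :
    hess (kdv l) u v (kdv m u) + gateaux (kdv l) u (gateaux (kdv m) u v)
      = hess (kdv m) u v (kdv l u) + gateaux (kdv m) u (gateaux (kdv l) u v) := by
  have h : ∀ l m, HasCurveDeriv
      (fun t : ℝ => gateaux (kdv l) (u + t • v) (kdv m (u + t • v)))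
      (hess (kdv l) u v (kdv m u) + gateaux (kdv l) u (gateaux (kdv m) u v)) := fun l m => by
    have := (isPolyMap_kdv l).hasCurveDeriv_gateaux (hasCurveDeriv_line u v)
      ((isPolyMap_kdv m).hasCurveDeriv u v)
    simp only [zero_smul, add_zero] at this
    rwa [(isPolyMap_kdv l).hess_comm u v]
  have h1 := h l m
  simp only [gateaux_kdv_comm l m] at h1
  exact h1.unique (h m l)

/-- The first component is commutation of the scalar flows; the second is its derivative along `η₁`
plus `a + b` times it. -/
theorem commutator_nonstdField (l m : ℕ) (a b : ℝ) (η : 𝓢(ℝ, ℝ) × 𝓢(ℝ, ℝ)) :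
    commutator (nonstdField l a) (nonstdField m b) η = 0 := by
  have hl := isPolyMap_kdv l
  have hm := isPolyMap_kdv m
  simp only [commutator, gateaux_nonstdField, nonstdField_apply, hl.gateaux_add, hm.gateaux_add,
    hl.gateaux_smul, hm.gateaux_smul]
  have h1 := gateaux_kdv_comm l m η.1
  have h2 := hess_kdv_comm l m η.1 η.2
  ext1
  · simp only [Prod.fst_sub, Prod.fst_zero, h1, sub_self]
  · simp only [Prod.snd_sub, Prod.snd_zero]
    linear_combination (norm := module) (a + b) • h1 + h2

theorem pair_gateaux_gradKdV_dx (l m : ℕ) (u v : 𝓢(ℝ, ℝ)) :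
    pair (gateaux (gradKdV l) u v) (dx (gradKdV m u))
      + pair (gradKdV l u) (dx (gateaux (gradKdV m) u v)) = 0 := by
  have h := ((isPolyMap_gradKdV l).hasCurveDeriv u v).pair
    ((isPolyMap_gradKdV m).hasCurveDeriv u v).dx
  simp only [pair_gradKdV_dx, zero_smul, add_zero] at h
  exact h.unique (hasCurveDeriv_const 0)

theorem pair2_gradPer_nonstdField (l m : ℕ) (a b : ℝ) (η : 𝓢(ℝ, ℝ) × 𝓢(ℝ, ℝ)) :
    pair2 (gradPer l a η) (nonstdField m b η) = 0 := by
  rw [nonstdField_apply, gradPer, pair2, gateaux_kdv, kdv_eq_dx_gradKdV]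
  simp only [pair_add_left, pair_add_right, pair_smul_left, pair_smul_right, pair_gradKdV_dx]
  linear_combination pair_gateaux_gradKdV_dx l m η.1 η.2

theorem isIntegrable_nonstdField {n : ℕ} (hn : 1 ≤ n) (α : ℝ) :
    IsIntegrable pair2 (nonstdField n α) := by
  -- The functional `per₁ H̃_m` generates the linearised `m`-th flow, that is, the perturbation
  -- field with `α = 0`.
  have e : ∀ m η, nonstdOps α 0 η (gradPer m 0 η) = nonstdField m 0 η := fun m η => by
    simp [nonstdField_apply, nonstdOps, blockOp_apply, gradPer, gateaux_kdv, kdv_eq_dx_gradKdV]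
  have h0 : ∀ m, IsVariationalDerivative pair2 (fun η => perFunctional (hamKdV m) η)
      (gradPer m 0) := fun m => by simpa using isVariationalDerivative_per m 0
  refine ⟨isSmooth_nonstdField n α, nonstdOps α 0, nonstdHams n α 0,
    fun m η => perFunctional (hamKdV m) η, fun m => gradPer m 0,
    isHamiltonianForm_nonstdField hn α 0, h0, fun m η => pair2_gradPer_nonstdField m n 0 α η,
    fun l m η => ?_, fun m η => ?_, fun l m η => ?_, fun N => ?_⟩
  · rw [e]
    exact pair2_gradPer_nonstdField l m 0 0 η
  · simp only [e]
    exact commutator_nonstdField n m α 0 η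
  · simp only [e]
    exact commutator_nonstdField l m 0 0 η
  · simp only [e]
    -- The first components are the scalar flows at `η₀`, so independence lifts, and the preimage of
    -- a dense set under the open projection is dense.
    refine ((dense_linearIndependent_kdv N).preimage isOpenMap_fst).mono fun η hη => ?_
    refine LinearIndependent.of_comp (LinearMap.fst ℝ 𝓢(ℝ, ℝ) 𝓢(ℝ, ℝ)) ?_
    have : (LinearMap.fst ℝ 𝓢(ℝ, ℝ) 𝓢(ℝ, ℝ)) ∘ (fun m : Fin N => nonstdField m 0 η)
        = fun m : Fin N => kdv m η.1 := by
      funext m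
      simp [nonstdField_apply]
    rw [this]
    exact hη

/-- Otherwise `K_n` would be constant along the ray from `0` to the triangular example, where it
goes from zero to a nonzero value. -/
theorem exists_gateaux_kdv_ne_zero (n : ℕ) : ∃ u w : 𝓢(ℝ, ℝ), gateaux (kdv n) u w ≠ 0 := by
  by_contra! hc
  obtain ⟨u, hu⟩ := exists_triangular (n + 1)
  have h1 := (hu n (Nat.lt_succ_self n)).1
  have hd : ∀ l : ℝ, HasDerivAt (fun l : ℝ => kdv n (l • u) n) 0 l := fun l => by
    refine HasCurveDeriv.hasDerivAt ?_
    have := ((isPolyMap_kdv n).hasCurveDeriv (l • u) u).clm (evalAt (n : ℝ))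
    rw [hc, map_zero] at this
    simpa only [add_smul, evalAt_apply] using this
  have hconst := is_const_of_deriv_eq_zero (fun l => (hd l).differentiableAt)
    (fun l => (hd l).deriv) 1 0
  have h0 : kdv n (0 : 𝓢(ℝ, ℝ)) = 0 := by simp [kdv]
  simp only [one_smul, zero_smul, h0, zero_apply] at hconst
  exact h1 hconst

theorem isIntegrableCoupling_nonstdField {n : ℕ} (hn : 1 ≤ n) {α : ℝ} (hα : α ≠ 0) :
    IsIntegrableCoupling pair pair2 (kdv n) (nonstdField n α) := by
  refine ⟨isIntegrable_kdv n, isIntegrable_nonstdField hn α,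
    fun u v => by rw [nonstdField_apply], ?_⟩
  obtain ⟨u, w, h⟩ := exists_gateaux_kdv_ne_zero n
  -- At `v = 0` the linearised term drops out, leaving `α K_n(u)`; this is where `α ≠ 0` enters.
  refine ⟨u, 0, w, α • gateaux (kdv n) u w, smul_ne_zero hα h, ?_⟩
  simp only [nonstdField_apply, (isPolyMap_kdv n).gateaux_zero, zero_add]
  exact ((isPolyMap_kdv n).hasCurveDeriv u w).const_smul α

end Integrability

end PerturbedKdV

end

/-! ### The main theorem. -/

theorem mainTheorem10 (n : ℕ) (hn : 1 ≤ n) (α : ℝ) (hα : α ≠ 0) :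
    -- the perturbation is genuinely differentiable in the parameter, and the system is
    -- `η₀_t = K_n(η₀)`, `η₁_t = K_n'(η₀)[η₁] + α K_n(η₀)`
    (∀ η₀ η₁ : SchwartzMap ℝ ℝ,
      PerturbedKdV.HasCurveDeriv
        (fun ε : ℝ => PerturbedKdV.kdvPer n α ε (η₀ + ε • η₁))
        (PerturbedKdV.nonstdField n α (η₀, η₁)).2) ∧
    (∀ η₀ η₁ : SchwartzMap ℝ ℝ,
      PerturbedKdV.nonstdField n α (η₀, η₁) =
        (PerturbedKdV.kdv n η₀,
          PerturbedKdV.gateaux (PerturbedKdV.kdv n) η₀ η₁ + α • PerturbedKdV.kdv n η₀)) ∧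
    -- integrable coupling of the `n`-th KdV equation
    PerturbedKdV.IsIntegrableCoupling PerturbedKdV.pair PerturbedKdV.pair2
      (PerturbedKdV.kdv n) (PerturbedKdV.nonstdField n α) ∧
    -- quadruple Hamiltonian formulation, with pairwise compatible Hamiltonian operators
    (∀ i j : Fin 4, PerturbedKdV.IsHamiltonianPair PerturbedKdV.pair2
      (PerturbedKdV.nonstdOps α i) (PerturbedKdV.nonstdOps α j)) ∧
    (∀ i : Fin 4, PerturbedKdV.IsHamiltonianForm PerturbedKdV.pair2
      (PerturbedKdV.nonstdField n α) (PerturbedKdV.nonstdOps α i)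
      (PerturbedKdV.nonstdHams n α i)) ∧
    -- two classes of hereditary recursion operators
    (∀ β₀ β₁ : ℝ,
      (PerturbedKdV.IsHereditary (PerturbedKdV.phiHat1 β₀ β₁) ∧
        PerturbedKdV.IsRecursionOperator (PerturbedKdV.nonstdField n α)
          (PerturbedKdV.phiHat1 β₀ β₁)) ∧
      (PerturbedKdV.IsHereditary (PerturbedKdV.phiHat2 β₀ β₁) ∧
        PerturbedKdV.IsRecursionOperator (PerturbedKdV.nonstdField n α)
          (PerturbedKdV.phiHat2 β₀ β₁))) := by
  refine ⟨fun η₀ η₁ => ?_, fun η₀ η₁ => PerturbedKdV.nonstdField_apply n α (η₀, η₁),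
    PerturbedKdV.isIntegrableCoupling_nonstdField hn hα,
    PerturbedKdV.isHamiltonianPair_nonstdOps α,
    PerturbedKdV.isHamiltonianForm_nonstdField hn α, fun β₀ β₁ =>
    ⟨⟨PerturbedKdV.isHereditary_phiHat1 β₀ β₁,
      PerturbedKdV.isRecursionOperator_phiHat1 n α β₀ β₁⟩,
      PerturbedKdV.isHereditary_phiHat2 β₀ β₁,
      PerturbedKdV.isRecursionOperator_phiHat2 n α β₀ β₁⟩⟩
  rw [PerturbedKdV.nonstdField_apply]
  exact PerturbedKdV.hasCurveDeriv_kdvPer n α η₀ η₁
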